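/- Let $p$ be a prime, $r\ge 1$, $q=p^r$, let $l$ be a prime with $l\neq 2$ and $l\neq p$, and let $k$ be a field with $\operatorname{char} k\neq l$. For $a\in\mathbb{F}_{q^2}$ put $\overline{a}=a^q$, and for a matrix $M$ over $\mathbb{F}_{q^2}$ let $\overline{M}$ be obtained by applying this to the entries. Let $n\ge 0$ and let $\beta$ be an invertible Hermitian $n\times n$ matrix over $\mathbb{F}_{q^2}$, that is, $\beta^T=\overline{\beta}$ and $\det\beta\neq 0$. Put $$U(n,q^2)=\{M\in GL_n(\mathbb{F}_{q^2}) : M^T\beta\overline{M}=\beta\},\qquad SU(n,q^2)=\{M\in U(n,q^2) : \det M=1\}.$$ For a finite group $G$ the essential $l$-dimension is $$\operatorname{ed}_k(G,l)=\sup_{F,\,t}\ \min_{F',\,E}\ \operatorname{trdeg}_k(E),$$ where $F$ runs over the field extensions of $k$ and $t$ over the $G$-torsors over $\operatorname{Spec}F$ (equivalently, Galois $G$-algebras over $F$), and the minimum is over all finite field extensions $F'/F$ with $l\nmid [F':F]$ and all intermediate fields $k\subseteq E\subseteq F'$ such that the base change of $t$ to $F'$ is isomorphic to the base change to $F'$ of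 some $G$-torsor over $\operatorname{Spec}E$. Then $$\operatorname{ed}_k(SU(n,q^2),l)=\begin{cases}\operatorname{ed}_k(U(n,q^2),l), & l\nmid q+1,\\ \operatorname{ed}_k(SL_n(\mathbb{F}_{q^2}),l), & l\mid q+1.\end{cases}$$ -/

import Mathlib

open scoped TensorProduct Matrix

universe u v

noncomputable section

/-- For an action `ρ` of `G` on a commutative `F`-algebra `L`, the canonical map
`L ⊗ L → ∏_{g ∈ G} L`, `a ⊗ b ↦ (a * ρ g b)_g`. On spectra it is the map
`G × X → X ×_F X` built from the action of `G` on `X = Spec L`. -/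
def torsorMap {G : Type v} [Group G] {F : Type u} [Field F] {L : Type u} [CommRing L]
    [Algebra F L] (ρ : G →* (L ≃ₐ[F] L)) : L ⊗[F] L →ₐ[F] (G → L) :=
  AlgHom.pi fun g =>
    Algebra.TensorProduct.productMap (AlgHom.id F L) (ρ g : L →ₐ[F] L)

/-- A `G`-torsor `Spec L → Spec F` for a finite group `G`, equivalently a Galois `G`-algebra `L`
over `F`: a nonzero commutative `F`-algebra with an action of `G` by `F`-algebra automorphisms for
which `L ⊗ L → ∏_{g ∈ G} L` is bijective. (Such an `L` is automatically étale of dimension `|G|`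
over `F`, with `F` as its ring of invariants.) -/
structure GTorsor (G : Type v) [Group G] (F : Type u) [Field F] where
  carrier : Type u
  [commRing : CommRing carrier]
  [algebra : Algebra F carrier]
  [nontrivial : Nontrivial carrier]
  action : G →* (carrier ≃ₐ[F] carrier)
  bijective : Function.Bijective (torsorMap action)

attribute [instance] GTorsor.commRing GTorsor.algebra GTorsor.nontrivial

/-- The action of `G` on the base change `F' ⊗ L` of a `G`-torsor `Spec L → Spec F` along `F → F'`:
`g` acts by `a ⊗ b ↦ a ⊗ g b`. -/
def GTorsor.baseChangeAction {G : Type v} [Group G] {F : Type u} [Field F] (t : GTorsor G F)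
    (F' : Type u) [Field F'] [Algebra F F'] (g : G) :
    (F' ⊗[F] t.carrier) →ₐ[F'] (F' ⊗[F] t.carrier) :=
  Algebra.TensorProduct.map (AlgHom.id F' F') (t.action g : t.carrier →ₐ[F] t.carrier)

/-- Let `t` be a `G`-torsor over `F`, and let `F → F'` and `E → F'` be field extensions. The image
of the class of `t` in `H¹(F'; G)` lies in the image of `H¹(E; G) → H¹(F'; G)`: some `G`-torsor
over `E` becomes isomorphic to `t` over `F'`. -/
def GTorsor.DescendsTo {G : Type v} [Group G] {F : Type u} [Field F] (t : GTorsor G F)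
    (F' : Type u) [Field F'] [Algebra F F'] (E : Type u) [Field E] [Algebra E F'] : Prop :=
  ∃ (t' : GTorsor G E) (e : (F' ⊗[F] t.carrier) ≃ₐ[F'] (F' ⊗[E] t'.carrier)),
    ∀ (g : G) (x : F' ⊗[F] t.carrier),
      e (t.baseChangeAction F' g x) = t'.baseChangeAction F' g (e x)

/-- The essential `l`-dimension `ed_k(t, l)` of a `G`-torsor `t` over a field `F ⊇ k`: the minimum
of `trdeg_k E` over all finite extensions `F'/F` of degree prime to `l` and all intermediate fields
`k ⊆ E ⊆ F'` such that `t` over `F'` descends to `E`. -/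
def GTorsor.essentialDim (k : Type u) [Field k] {G : Type v} [Group G] {F : Type u} [Field F]
    [Algebra k F] (t : GTorsor G F) (l : ℕ) : ℕ∞ :=
  ⨅ (F' : Type u) (_ : Field F') (_ : Algebra k F') (_ : Algebra F F') (_ : IsScalarTower k F F')
    (_ : FiniteDimensional F F') (_ : ¬ l ∣ Module.finrank F F')
    (E : IntermediateField k F') (_ : t.DescendsTo F' E),
    Cardinal.toENat (Algebra.trdeg k E)

/-- The essential `l`-dimension `ed_k(G, l)` of a finite group `G`: the supremum of `ed_k(t, l)`
over all field extensions `F/k` and all `G`-torsors `t` over `F`. -/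
def essentialDim (k : Type u) [Field k] (G : Type v) [Group G] (l : ℕ) : ℕ∞ :=
  ⨆ (F : Type u) (_ : Field F) (_ : Algebra k F) (t : GTorsor G F), t.essentialDim k l

/-- The unitary group `{M ∈ GL_n(R) : Mᵀ β (σ M) = β}` of the matrix `β`, where `σ` is a ring
endomorphism applied to the entries of `M`. -/
def matUnitary {n : ℕ} {R : Type v} [CommRing R] (σ : R →+* R)
    (β : Matrix (Fin n) (Fin n) R) : Subgroup (GL (Fin n) R) where
  carrier := {M | (M : Matrix (Fin n) (Fin n) R)ᵀ * β *
    (M : Matrix (Fin n) (Fin n) R).map σ = β}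
  one_mem' := by simp
  mul_mem' := by
    intro A B hA hB
    simp only [Set.mem_ofPred_eq, Units.val_mul, Matrix.transpose_mul, Matrix.map_mul] at hA hB ⊢
    calc _ = (B : Matrix (Fin n) (Fin n) R)ᵀ * ((A : Matrix (Fin n) (Fin n) R)ᵀ * β *
            (A : Matrix (Fin n) (Fin n) R).map σ) * (B : Matrix (Fin n) (Fin n) R).map σ := by
          simp only [Matrix.mul_assoc]
      _ = β := by rw [hA, hB]
  inv_mem' := by
    intro A hA
    simp only [Set.mem_ofPred_eq] at hA ⊢
    have h1 : (A : Matrix (Fin n) (Fin n) R) * ((A⁻¹ : GL (Fin n) R) : Matrix _ _ R) = 1 := by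
      rw [← Units.val_mul, mul_inv_cancel, Units.val_one]
    have h2 : ((A⁻¹ : GL (Fin n) R) : Matrix _ _ R)ᵀ * (A : Matrix (Fin n) (Fin n) R)ᵀ = 1 := by
      rw [← Matrix.transpose_mul, h1, Matrix.transpose_one]
    have h3 : (A : Matrix (Fin n) (Fin n) R).map σ *
        ((A⁻¹ : GL (Fin n) R) : Matrix (Fin n) (Fin n) R).map σ = 1 := by
      rw [← Matrix.map_mul, h1]; simp
    calc _ = ((A⁻¹ : GL (Fin n) R) : Matrix (Fin n) (Fin n) R)ᵀ *
            ((A : Matrix (Fin n) (Fin n) R)ᵀ * β * (A : Matrix (Fin n) (Fin n) R).map σ) *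
            ((A⁻¹ : GL (Fin n) R) : Matrix (Fin n) (Fin n) R).map σ := by rw [hA]
      _ = (((A⁻¹ : GL (Fin n) R) : Matrix (Fin n) (Fin n) R)ᵀ *
            (A : Matrix (Fin n) (Fin n) R)ᵀ) * β * ((A : Matrix (Fin n) (Fin n) R).map σ *
            ((A⁻¹ : GL (Fin n) R) : Matrix (Fin n) (Fin n) R).map σ) := by
          simp only [Matrix.mul_assoc]
      _ = β := by rw [h2, h3, Matrix.one_mul, Matrix.mul_one]

/-- The special unitary group: the elements of determinant `1` of the unitary group of `β`. -/
def matSpecialUnitary {n : ℕ} {R : Type v} [CommRing R] (σ : R →+* R)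
    (β : Matrix (Fin n) (Fin n) R) : Subgroup (GL (Fin n) R) :=
  matUnitary σ β ⊓ (Matrix.GeneralLinearGroup.det (n := Fin n) (R := R)).ker

end

/-! Everything follows from one principle, `essentialDim_eq_of_injective`: a subgroup H of a finite
group G whose index is prime to `l` has the same essential `l`-dimension as G. For ed(H) ≤ ed(G),
induce an H-torsor to G, descend the induced torsor, and project back to H. The field of definition
may grow in the last move, but only algebraically, so its transcendence degree is unchanged
(`exists_descent_of_equivariant`). For ed(G) ≤ ed(H), the invariants of H in a Galois G-algebra form
a product of fields of total degree [G : H]. One of these fields has degree prime to `l`, and over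
it the torsor reduces to H (`exists_reduction`). A descent of the reduction is then induced back to
G. These arguments run on dual systems (`IsGaloisAction`), which give explicit formulas and survive
base change, induction and passage to quotients.

It remains to compute two indices. Write q = p ^ r. Determinants of unitary matrices satisfy x ^ (q
+ 1) = 1, so [U : SU] is prime to `l` when `l` does not divide q + 1. If `l` divides q + 1, then [SL
: SU] divides [GL : U] because SL is normal in GL. The form is congruent to the identity, so U
contains a conjugate of the monomial group of order (q + 1) ^ n * n!. Lifting the exponent shows
that this order already carries the full power of `l` in |GL|, hence [GL : U] is prime to `l`. -/

noncomputable section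

/-! ### Galois algebras, dual systems and traces -/

section GaloisAction

variable {G : Type v} [Group G] {F : Type u} [Field F]

/-- An action of `G` on a commutative `F`-algebra `L` with `F` as ring of invariants and with a
dual system `a, b`, that is `∑ i, a i * g (b i) = δ_{g, 1}`. -/
structure IsGaloisAction {L : Type u} [CommRing L] [Algebra F L] (ρ : G → L →ₐ[F] L) : Prop where
  map_one : ∀ x, ρ 1 x = x
  map_mul : ∀ g h x, ρ (g * h) x = ρ g (ρ h x)
  invariant : ∀ x, (∀ g, ρ g x = x) → ∃ c : F, algebraMap F L c = x
  dual : ∃ (ι : Type u) (_ : Fintype ι) (a b : ι → L), ∑ i, a i * b i = 1 ∧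
    ∀ g, g ≠ 1 → ∑ i, a i * ρ g (b i) = 0

variable {L : Type u} [CommRing L] [Algebra F L]

theorem torsorMap_tmul (ρ : G →* (L ≃ₐ[F] L)) (a b : L) (g : G) :
    torsorMap ρ (a ⊗ₜ b) g = a * ρ g b := by
  simp [torsorMap]

/-- A dual system expresses every element through traces. -/
theorem sum_dual_mul_trace [Fintype G] {ρ : G → L →ₐ[F] L} (h1 : ∀ x, ρ 1 x = x)
    {ι : Type*} [Fintype ι] {a b : ι → L} (hab : ∑ i, a i * b i = 1)
    (hab' : ∀ g, g ≠ 1 → ∑ i, a i * ρ g (b i) = 0) (x : L) :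
    ∑ i, a i * ∑ g, ρ g (b i * x) = x := by
  classical
  have : ∑ i, a i * ∑ g, ρ g (b i * x) = ∑ g, (∑ i, a i * ρ g (b i)) * ρ g x := by
    simp only [Finset.mul_sum, Finset.sum_mul]
    rw [Finset.sum_comm]
    simp [mul_assoc]
  rw [this, Finset.sum_eq_single 1]
  · simp [h1, hab]
  · intro g _ hg; simp [hab' g hg]
  · simp

theorem apply_trace [Fintype G] {ρ : G → L →ₐ[F] L}
    (hmul : ∀ g h x, ρ (g * h) x = ρ g (ρ h x)) (h : G) (x : L) :
    ρ h (∑ g, ρ g x) = ∑ g, ρ g x := by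
  rw [map_sum]
  simp only [← hmul]
  exact Fintype.sum_equiv (Equiv.mulLeft h) _ _ (fun _ => rfl)

namespace IsGaloisAction

theorem exists_trace [Fintype G] {ρ : G → L →ₐ[F] L} (h : IsGaloisAction ρ) (x : L) :
    ∃ c : F, algebraMap F L c = ∑ g, ρ g x :=
  h.invariant _ fun g => apply_trace h.map_mul g x

/-- If all traces vanished, the dual expansion of 1 would give 1 = 0. A nonzero trace is a scalar of
`F` and can be normalized. -/
theorem exists_trace_eq_one [Nontrivial L] [Fintype G] {ρ : G → L →ₐ[F] L}
    (h : IsGaloisAction ρ) : ∃ x : L, ∑ g, ρ g x = 1 := by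
  obtain ⟨ι, _, a, b, hab, hab'⟩ := h.dual
  by_contra! hne
  have h0 : ∀ x : L, ∑ g, ρ g x = 0 := by
    intro x
    obtain ⟨c, hc⟩ := h.exists_trace x
    by_contra hx
    have hc0 : c ≠ 0 := by rintro rfl; exact hx (by rw [← hc, map_zero])
    apply hne (c⁻¹ • x)
    have : ∑ g, ρ g (c⁻¹ • x) = c⁻¹ • ∑ g, ρ g x := by
      rw [Finset.smul_sum]
      exact Finset.sum_congr rfl fun g _ => (ρ g).map_smul_of_tower _ _
    rw [this, ← hc, Algebra.smul_def, ← _root_.map_mul, inv_mul_cancel₀ hc0, _root_.map_one]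
  have := sum_dual_mul_trace h.map_one hab hab' 1
  simp [h0] at this

theorem finite [Finite G] {ρ : G → L →ₐ[F] L} (h : IsGaloisAction ρ) : Module.Finite F L := by
  have := Fintype.ofFinite G
  obtain ⟨ι, _, a, b, hab, hab'⟩ := h.dual
  refine Module.Finite.of_surjective (Fintype.linearCombination F a) fun x => ?_
  choose c hc using h.exists_trace
  refine ⟨fun i => c (b i * x), ?_⟩
  rw [Fintype.linearCombination_apply]
  conv_rhs => rw [← sum_dual_mul_trace h.map_one hab hab' x]
  simp only [← hc, Algebra.smul_def, mul_comm]

/-- The traces of `b i * x` for nilpotent `x` are nilpotent elements of the field `F`, hence zero,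
and they are the coefficients of `x`. -/
theorem isReduced [Finite G] {ρ : G → L →ₐ[F] L} (h : IsGaloisAction ρ) : IsReduced L := by
  have := Fintype.ofFinite G
  nontriviality L
  obtain ⟨ι, _, a, b, hab, hab'⟩ := h.dual
  refine ⟨fun x hx => ?_⟩
  rw [← sum_dual_mul_trace h.map_one hab hab' x]
  refine Finset.sum_eq_zero fun i _ => ?_
  have hn : IsNilpotent (∑ g, ρ g (b i * x)) := by
    refine isNilpotent_sum fun g _ => ?_
    exact ((Commute.all (b i) x).isNilpotent_mul_left hx).map (ρ g)
  obtain ⟨c, hc⟩ := h.exists_trace (b i * x)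
  rw [← hc, IsNilpotent.map_iff (algebraMap F L).injective, isNilpotent_iff_eq_zero] at hn
  rw [← hc, hn]
  simp

/-- An equivariant homomorphism between Galois algebras is an isomorphism. -/
theorem bijective_of_equivariant [Finite G] {M : Type u} [CommRing M] [Algebra F M] [Nontrivial M]
    {ρ : G → L →ₐ[F] L} {τ : G → M →ₐ[F] M} (hρ : IsGaloisAction ρ) (hτ : IsGaloisAction τ)
    (f : L →ₐ[F] M) (hf : ∀ g x, f (ρ g x) = τ g (f x)) : Function.Bijective f := by
  have := Fintype.ofFinite G
  obtain ⟨ι, _, a, b, hab, hab'⟩ := hρ.dual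
  constructor
  -- The coefficients of `x` are scalars, and `f` is injective on scalars.
  · rw [injective_iff_map_eq_zero]
    intro x hx
    rw [← sum_dual_mul_trace hρ.map_one hab hab' x]
    refine Finset.sum_eq_zero fun i _ => ?_
    obtain ⟨c, hc⟩ := hρ.exists_trace (b i * x)
    have : algebraMap F M c = 0 := by
      rw [← f.commutes, hc, map_sum]
      simp [hf, hx]
    rw [map_eq_zero] at this
    rw [← hc, this]; simp
  · intro y
    -- By equivariance `f` carries the dual system to a dual system of `M`, so the `f (a i)` span
    -- `M` over `F`.
    have hd := sum_dual_mul_trace (ρ := τ) (a := fun i => f (a i)) (b := fun i => f (b i))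
      hτ.map_one (by simp only [← _root_.map_mul, ← map_sum, hab, _root_.map_one])
      (fun g hg => by simp only [← hf, ← _root_.map_mul, ← map_sum, hab' g hg, map_zero]) y
    choose c hc using hτ.exists_trace
    refine ⟨∑ i, a i * algebraMap F L (c (f (b i) * y)), ?_⟩
    conv_rhs => rw [← hd]
    simp [hc]

/-- The action of a Galois algebra as a homomorphism to its automorphism group. -/
def toMonoidHom {ρ : G → L →ₐ[F] L} (h : IsGaloisAction ρ) : G →* (L ≃ₐ[F] L) where
  toFun g := AlgEquiv.ofAlgHom (ρ g) (ρ g⁻¹)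
    (by ext x; simp [← h.map_mul, h.map_one]) (by ext x; simp [← h.map_mul, h.map_one])
  map_one' := by ext x; simp [h.map_one]
  map_mul' g g' := by ext x; simp [h.map_mul]

@[simp]
theorem toMonoidHom_apply {ρ : G → L →ₐ[F] L} (h : IsGaloisAction ρ) (g : G) (x : L) :
    h.toMonoidHom g x = ρ g x := rfl

theorem bijective_torsorMap [Finite G] {ρ : G → L →ₐ[F] L} (h : IsGaloisAction ρ) :
    Function.Bijective (torsorMap h.toMonoidHom) := by
  classical
  have := Fintype.ofFinite G
  obtain ⟨ι, _, a, b, hab, hab'⟩ := h.dual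
  constructor
  · rw [injective_iff_map_eq_zero]
    intro z hz
    choose c hc using h.exists_trace
    -- An explicit left inverse: `z` is recovered from its image by means of the dual system.
    have key : ∀ z : L ⊗[F] L,
        z = ∑ i, (∑ g, ρ g (b i) * torsorMap h.toMonoidHom z g) ⊗ₜ[F] a i := by
      intro z
      induction z with
      | zero => simp
      | add x y hx hy =>
        conv_lhs => rw [hx, hy]
        simp [mul_add, Finset.sum_add_distrib, TensorProduct.add_tmul]
      | tmul x y =>
        conv_lhs => rw [← sum_dual_mul_trace h.map_one hab hab' y]
        rw [TensorProduct.tmul_sum]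
        refine Finset.sum_congr rfl fun i _ => ?_
        have : ∑ g, ρ g (b i) * torsorMap h.toMonoidHom (x ⊗ₜ y) g = c (b i * y) • x := by
          simp only [torsorMap_tmul, toMonoidHom_apply, Algebra.smul_def, hc, Finset.sum_mul,
            _root_.map_mul]
          exact Finset.sum_congr rfl fun g _ => by ring
        rw [this, ← hc, mul_comm, ← Algebra.smul_def, TensorProduct.smul_tmul]
    rw [key z]
    simp [hz]
  · intro f
    refine ⟨∑ g, ∑ i, (f g * a i) ⊗ₜ[F] ρ g⁻¹ (b i), ?_⟩
    ext g
    simp only [map_sum, Finset.sum_apply, torsorMap_tmul, toMonoidHom_apply, ← h.map_mul, mul_assoc,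
      ← Finset.mul_sum]
    rw [Finset.sum_eq_single g]
    · simp [h.map_one, hab]
    · intro g' _ hg'
      rw [hab' _ (by rwa [Ne, mul_inv_eq_one, eq_comm]), mul_zero]
    · simp

/-- The torsor of a Galois algebra. -/
abbrev toGTorsor [Finite G] [Nontrivial L] {ρ : G → L →ₐ[F] L} (h : IsGaloisAction ρ) :
    GTorsor G F where
  carrier := L
  action := h.toMonoidHom
  bijective := h.bijective_torsorMap

end IsGaloisAction

/-- Contract the first factor with an `F`-linear retraction of `F → L`. -/
theorem exists_algebraMap_eq_of_tmul_comm [Nontrivial L] {x : L}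
    (h : x ⊗ₜ[F] (1 : L) = 1 ⊗ₜ[F] x) : ∃ c : F, algebraMap F L c = x := by
  obtain ⟨f, hf⟩ := (Algebra.linearMap F L).exists_leftInverse_of_injective
    (LinearMap.ker_eq_bot.2 (algebraMap F L).injective)
  have hf1 : f 1 = 1 := by simpa using LinearMap.congr_fun hf 1
  refine ⟨f x, ?_⟩
  have := congrArg (TensorProduct.lift ((LinearMap.lsmul F L).comp f)) h
  simpa [hf1, Algebra.smul_def] using this

/-- A dual system is a tensor mapping to the indicator of `1`. For invariant `x`, the tensors `x ⊗
1` and `1 ⊗ x` have the same image, so they coincide. -/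
theorem GTorsor.isGaloisAction [Finite G] (t : GTorsor G F) :
    IsGaloisAction (fun g => (t.action g : t.carrier →ₐ[F] t.carrier)) where
  map_one x := by simp
  map_mul g h x := by simp
  invariant x hx := by
    apply exists_algebraMap_eq_of_tmul_comm
    apply t.bijective.1
    ext g
    simpa [torsorMap_tmul] using (hx g).symm
  dual := by
    classical
    obtain ⟨z, hz⟩ := t.bijective.2 (Pi.single 1 1)
    obtain ⟨s, hs⟩ := TensorProduct.exists_finset z
    have key : ∀ g, ∑ i : s, i.1.1 * t.action g i.1.2 = (Pi.single 1 1 : G → t.carrier) g := by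
      intro g
      rw [← hz, hs, map_sum, Finset.sum_apply, ← Finset.sum_coe_sort s]
      simp [torsorMap_tmul]
    refine ⟨s, inferInstance, fun i => i.1.1, fun i => i.1.2, ?_, fun g hg => ?_⟩
    · simpa using key 1
    · simpa [hg] using key g

end GaloisAction

/-! ### Base change of Galois algebras -/

section BaseChange

variable {G : Type v} [Group G] {F : Type u} [Field F]

instance (t : GTorsor G F) (F' : Type u) [Field F'] [Algebra F F'] :
    Nontrivial (F' ⊗[F] t.carrier) :=
  inferInstance

theorem GTorsor.isGaloisAction_baseChange [Finite G] (t : GTorsor G F)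
    (F' : Type u) [Field F'] [Algebra F F'] : IsGaloisAction (t.baseChangeAction F') where
  map_one x := by
    induction x with
    | zero => simp
    | add x y hx hy => simp only [map_add, hx, hy]
    | tmul x y => simp [GTorsor.baseChangeAction]
  map_mul g h x := by
    induction x with
    | zero => simp
    | add x y hx hy => simp only [map_add, hx, hy]
    | tmul x y => simp [GTorsor.baseChangeAction]
  invariant x hx := by
    have := Fintype.ofFinite G
    obtain ⟨c, hc⟩ := t.isGaloisAction.exists_trace_eq_one
    -- Traces on the base change are scalars, and an invariant `x` is the trace of `(1 ⊗ c) * x`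
    -- when `c` has trace 1.
    have key : ∀ z : F' ⊗[F] t.carrier, ∃ d : F',
        algebraMap F' (F' ⊗[F] t.carrier) d = ∑ g, t.baseChangeAction F' g z := by
      intro z
      induction z with
      | zero => exact ⟨0, by simp⟩
      | add x y hx hy =>
        obtain ⟨d, hd⟩ := hx
        obtain ⟨e, he⟩ := hy
        exact ⟨d + e, by simp only [map_add, hd, he, Finset.sum_add_distrib]⟩
      | tmul x y =>
        obtain ⟨d, hd⟩ := t.isGaloisAction.exists_trace y
        refine ⟨d • x, ?_⟩
        simp only [GTorsor.baseChangeAction, Algebra.TensorProduct.map_tmul, AlgHom.id_apply,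
          ← TensorProduct.tmul_sum]
        rw [← hd, Algebra.algebraMap_eq_smul_one d, TensorProduct.tmul_smul,
          TensorProduct.smul_tmul']
        rfl
    obtain ⟨d, hd⟩ := key ((1 ⊗ₜ c) * x)
    refine ⟨d, hd.trans ?_⟩
    simp only [map_mul, hx, ← Finset.sum_mul]
    simp only [GTorsor.baseChangeAction, Algebra.TensorProduct.map_tmul, AlgHom.id_apply,
          ← TensorProduct.tmul_sum]
    rw [hc, ← Algebra.TensorProduct.one_def, one_mul]
  dual := by
    obtain ⟨ι, hι, a, b, hab, hab'⟩ := t.isGaloisAction.dual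
    refine ⟨ι, hι, fun i => 1 ⊗ₜ a i, fun i => 1 ⊗ₜ b i, ?_, fun g hg => ?_⟩
    · simp [← TensorProduct.tmul_sum, hab, Algebra.TensorProduct.one_def]
    · simpa [GTorsor.baseChangeAction, ← TensorProduct.tmul_sum] using
        congrArg (fun x => (1 : F') ⊗ₜ[F] x) (hab' g hg)

end BaseChange

/-! ### Induction from a subgroup -/

section Induced

variable {G : Type u} [Group G] {H : Subgroup G} {F : Type u} [Field F]
  {C : Type u} [CommRing C] [Algebra F C]

/-- The algebra induced from an `H`-algebra `C`: the `H`-equivariant functions `G → C`. -/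
def inducedAlgebra (τ : H → C →ₐ[F] C) : Subalgebra F (G → C) where
  carrier := {f | ∀ (h : H) (x : G), f (h * x) = τ h (f x)}
  mul_mem' := by intro f g hf hg h x; simp [hf h x, hg h x]
  add_mem' := by intro f g hf hg h x; simp [hf h x, hg h x]
  algebraMap_mem' := by intro r h x; simp

/-- The action of `G` on the induced algebra by right translation. -/
def inducedAction (τ : H → C →ₐ[F] C) (g : G) : inducedAlgebra τ →ₐ[F] inducedAlgebra τ where
  toFun f := ⟨fun x => f.1 (x * g), fun h x => by simpa [mul_assoc] using f.2 h (x * g)⟩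
  map_one' := rfl
  map_mul' _ _ := rfl
  map_zero' := rfl
  map_add' _ _ := rfl
  commutes' _ := rfl

@[simp]
theorem inducedAction_apply (τ : H → C →ₐ[F] C) (g x : G) (f : inducedAlgebra τ) :
    (inducedAction τ g f).1 x = f.1 (x * g) := rfl

/-- Evaluation at `1` on the induced algebra. -/
def inducedEval (τ : H → C →ₐ[F] C) : inducedAlgebra τ →ₐ[F] C :=
  (Pi.evalAlgHom F (fun _ : G => C) 1).comp (inducedAlgebra τ).val

theorem inducedEval_apply (τ : H → C →ₐ[F] C) (f : inducedAlgebra τ) :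
    inducedEval τ f = f.1 1 := rfl

theorem inducedEval_equivariant (τ : H → C →ₐ[F] C) (h : H) (f : inducedAlgebra τ) :
    inducedEval τ (inducedAction τ h f) = τ h (inducedEval τ f) := by
  have := f.2 h 1
  simpa [inducedEval_apply] using this

instance [Nontrivial C] (τ : H → C →ₐ[F] C) : Nontrivial (inducedAlgebra τ) :=
  (inducedEval τ).toRingHom.domain_nontrivial

open Classical in
/-- The function supported on the coset `H s` which is determined by its value `c` at `s`. -/
def inducedExtend {τ : H → C →ₐ[F] C} (hmul : ∀ g h x, τ (g * h) x = τ g (τ h x)) (s : G) (c : C) :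
    inducedAlgebra τ :=
  ⟨fun x => if hx : x * s⁻¹ ∈ H then τ ⟨x * s⁻¹, hx⟩ c else 0, by
    intro h x
    have hiff : (h : G) * x * s⁻¹ ∈ H ↔ x * s⁻¹ ∈ H := by
      rw [mul_assoc, Subgroup.mul_mem_cancel_left _ h.2]
    beta_reduce
    by_cases hx : x * s⁻¹ ∈ H
    · rw [dif_pos hx, dif_pos (hiff.2 hx), ← hmul]
      congr 2
      ext
      simp [mul_assoc]
    · rw [dif_neg hx, dif_neg (fun h' => hx (hiff.1 h')), map_zero]⟩

theorem inducedExtend_of_mem {τ : H → C →ₐ[F] C} (hmul : ∀ g h x, τ (g * h) x = τ g (τ h x))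
    {s x : G} (hx : x * s⁻¹ ∈ H) (c : C) :
    (inducedExtend hmul s c).1 x = τ ⟨x * s⁻¹, hx⟩ c :=
  dif_pos hx

theorem inducedExtend_of_notMem {τ : H → C →ₐ[F] C} (hmul : ∀ g h x, τ (g * h) x = τ g (τ h x))
    {s x : G} (hx : x * s⁻¹ ∉ H) (c : C) :
    (inducedExtend hmul s c).1 x = 0 :=
  dif_neg hx

theorem isGaloisAction_induced [Finite G] {τ : H → C →ₐ[F] C} (hτ : IsGaloisAction τ) :
    IsGaloisAction (inducedAction τ) where
  map_one f := by ext x; simp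
  map_mul g h f := by ext x; simp [mul_assoc]
  invariant f hf := by
    have hconst : ∀ x, f.1 x = f.1 1 := fun x => by
      conv_rhs => rw [← hf x]
      simp
    obtain ⟨c, hc⟩ := hτ.invariant (f.1 1) fun h => by rw [← f.2 h 1]; exact hconst _
    refine ⟨c, ?_⟩
    ext x
    rw [hconst x, ← hc]
    rfl
  dual := by
    classical
    obtain ⟨ι, hι, a, b, hab, hab'⟩ := hτ.dual
    -- The dual system is the one of `C`, placed on each right coset of `H` through a
    -- representative. At `x` only the coset of `x` contributes.
    let Q := Quotient (QuotientGroup.rightRel H)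
    have : Fintype Q := Fintype.ofFinite _
    have hout : ∀ x : G, x * (Quotient.out (Quotient.mk'' x : Q))⁻¹ ∈ H := fun x => by
      have := Quotient.mk_out (s := QuotientGroup.rightRel H) x
      exact QuotientGroup.rightRel_apply.1 this
    have huniq : ∀ (x : G) (s : Q), x * (Quotient.out s)⁻¹ ∈ H → s = Quotient.mk'' x := by
      intro x s hs
      rw [← Quotient.out_eq' s, Quotient.eq'', QuotientGroup.rightRel_apply]
      exact hs
    have key : ∀ (g x : G), ∑ i : Q × ι, (inducedExtend hτ.map_mul i.1.out (a i.2)).1 x *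
        (inducedExtend hτ.map_mul i.1.out (b i.2)).1 (x * g) =
        if g = 1 then 1 else 0 := by
      intro g x
      rw [Fintype.sum_prod_type, Finset.sum_eq_single (Quotient.mk'' x : Q)]
      · dsimp only
        have hx := hout x
        set s : G := Quotient.out (Quotient.mk'' x : Q) with hs
        simp only [inducedExtend_of_mem _ hx]
        by_cases hxg : x * g * s⁻¹ ∈ H
        · simp only [inducedExtend_of_mem _ hxg]
          have hsplit : (⟨x * g * s⁻¹, hxg⟩ : H) =
              ⟨x * s⁻¹, hx⟩ * (⟨x * s⁻¹, hx⟩⁻¹ * ⟨x * g * s⁻¹, hxg⟩) := by group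
          have : ∀ i, τ ⟨x * s⁻¹, hx⟩ (a i) * τ ⟨x * g * s⁻¹, hxg⟩ (b i) =
              τ ⟨x * s⁻¹, hx⟩ (a i * τ (⟨x * s⁻¹, hx⟩⁻¹ * ⟨x * g * s⁻¹, hxg⟩) (b i)) := by
            intro i
            rw [map_mul, ← hτ.map_mul, ← hsplit]
          simp only [this, ← map_sum]
          by_cases hg : g = 1
          · subst hg
            simp [hτ.map_one, hab]
          · rw [hab', map_zero, if_neg hg]
            intro h1
            rw [inv_mul_eq_one, Subtype.mk.injEq] at h1
            exact hg (by simpa using h1)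
        · simp only [inducedExtend_of_notMem _ hxg, mul_zero, Finset.sum_const_zero]
          rw [if_neg]
          rintro rfl
          exact hxg (by simpa using hx)
      · intro s _ hs
        refine Finset.sum_eq_zero fun i _ => ?_
        have : ¬ x * (Quotient.out s)⁻¹ ∈ H := fun h => hs (huniq x s h)
        simp [inducedExtend_of_notMem _ this]
      · simp
    refine ⟨Q × ι, inferInstance, fun i => inducedExtend hτ.map_mul i.1.out (a i.2),
      fun i => inducedExtend hτ.map_mul i.1.out (b i.2), ?_, fun g hg => ?_⟩
    · ext x
      simpa using key 1 x
    · ext x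
      simpa [hg] using key g x

/-- An `H`-equivariant homomorphism to `C` extends to a `G`-equivariant homomorphism to the
induced algebra. -/
def inducedLift {A : Type u} [CommRing A] [Algebra F A] {ρ : G → A →ₐ[F] A} {τ : H → C →ₐ[F] C}
    (hmul : ∀ g h x, ρ (g * h) x = ρ g (ρ h x))
    (f : A →ₐ[F] C) (hf : ∀ (h : H) x, f (ρ h x) = τ h (f x)) : A →ₐ[F] inducedAlgebra τ :=
  (AlgHom.pi fun x : G => f.comp (ρ x)).codRestrict _ fun a h x => by
    simp [hmul, hf]

@[simp]
theorem inducedLift_apply {A : Type u} [CommRing A] [Algebra F A] {ρ : G → A →ₐ[F] A}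
    {τ : H → C →ₐ[F] C} (hmul : ∀ g h x, ρ (g * h) x = ρ g (ρ h x))
    (f : A →ₐ[F] C) (hf : ∀ (h : H) x, f (ρ h x) = τ h (f x)) (a : A) (x : G) :
    (inducedLift hmul f hf a).1 x = f (ρ x a) := rfl

/-- Two Galois `G`-algebras with `H`-equivariant homomorphisms to the same Galois `H`-algebra are
isomorphic. -/
theorem exists_algEquiv_of_equivariant [Finite G] [Nontrivial C] {τ : H → C →ₐ[F] C}
    (hτ : IsGaloisAction τ)
    {A : Type u} [CommRing A] [Algebra F A] {ρ : G → A →ₐ[F] A} (hρ : IsGaloisAction ρ)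
    (f : A →ₐ[F] C) (hf : ∀ (h : H) x, f (ρ h x) = τ h (f x))
    {A' : Type u} [CommRing A'] [Algebra F A'] {ρ' : G → A' →ₐ[F] A'} (hρ' : IsGaloisAction ρ')
    (f' : A' →ₐ[F] C) (hf' : ∀ (h : H) x, f' (ρ' h x) = τ h (f' x)) :
    ∃ e : A ≃ₐ[F] A', ∀ g x, e (ρ g x) = ρ' g (e x) := by
  have h1 : ∀ g x, inducedLift hρ.map_mul f hf (ρ g x) =
      inducedAction τ g (inducedLift hρ.map_mul f hf x) := by
    intro g x; ext y; simp [hρ.map_mul]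
  have h2 : ∀ g x, inducedLift hρ'.map_mul f' hf' (ρ' g x) =
      inducedAction τ g (inducedLift hρ'.map_mul f' hf' x) := by
    intro g x; ext y; simp [hρ'.map_mul]
  let e1 := AlgEquiv.ofBijective _ (hρ.bijective_of_equivariant (isGaloisAction_induced hτ) _ h1)
  let e2 := AlgEquiv.ofBijective _ (hρ'.bijective_of_equivariant (isGaloisAction_induced hτ) _ h2)
  refine ⟨e1.trans e2.symm, fun g x => ?_⟩
  apply e2.injective
  have h1' : e1 (ρ g x) = inducedAction τ g (e1 x) := h1 g x
  have h2' : ∀ y, e2 (ρ' g y) = inducedAction τ g (e2 y) := fun y => h2 g y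
  simp [h1', h2']

end Induced

/-! ### Bounds for essential dimension -/

section EssentialDim

variable {k : Type u} [Field k] {G : Type v} [Group G] {l : ℕ}

theorem GTorsor.essentialDim_le {F : Type u} [Field F] [Algebra k F] (t : GTorsor G F)
    (F' : Type u) [i₁ : Field F'] [i₂ : Algebra k F'] [i₃ : Algebra F F']
    [i₄ : IsScalarTower k F F'] [i₅ : FiniteDimensional F F'] (hl : ¬ l ∣ Module.finrank F F')
    (E : IntermediateField k F') (h : t.DescendsTo F' E) :
    t.essentialDim k l ≤ Cardinal.toENat (Algebra.trdeg k E) := by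
  unfold GTorsor.essentialDim
  refine (iInf_le _ F').trans ((iInf_le _ i₁).trans ((iInf_le _ i₂).trans ((iInf_le _ i₃).trans ?_)))
  exact (iInf_le _ i₄).trans ((iInf_le _ i₅).trans ((iInf_le _ hl).trans
    ((iInf_le _ E).trans (iInf_le _ h))))

theorem GTorsor.le_essentialDim {F : Type u} [Field F] [Algebra k F] (t : GTorsor G F) {d : ℕ∞}
    (h : ∀ (F' : Type u) [Field F'] [Algebra k F'] [Algebra F F'] [IsScalarTower k F F']
      [FiniteDimensional F F'] (_ : ¬ l ∣ Module.finrank F F') (E : IntermediateField k F')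
      (_ : t.DescendsTo F' E), d ≤ Cardinal.toENat (Algebra.trdeg k E)) :
    d ≤ t.essentialDim k l :=
  le_iInf fun F' => le_iInf fun _ => le_iInf fun _ => le_iInf fun _ => le_iInf fun _ =>
    le_iInf fun _ => le_iInf fun hl => le_iInf fun E => le_iInf fun h' => h F' hl E h'

theorem GTorsor.essentialDim_le_essentialDim {F : Type u} [i₁ : Field F] [i₂ : Algebra k F]
    (t : GTorsor G F) : t.essentialDim k l ≤ _root_.essentialDim k G l := by
  unfold _root_.essentialDim
  exact (le_iSup (fun t : GTorsor G F => t.essentialDim k l) t).trans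
    ((le_iSup (fun i₂ : Algebra k F => ⨆ t : GTorsor G F, t.essentialDim k l) i₂).trans
      ((le_iSup (fun i₁ : Field F => ⨆ (_ : Algebra k F) (t : GTorsor G F),
        t.essentialDim k l) i₁).trans (le_iSup (fun (F : Type u) => ⨆ (_ : Field F)
          (_ : Algebra k F) (t : GTorsor G F), t.essentialDim k l) F)))

theorem essentialDim_le {d : ℕ∞}
    (h : ∀ (F : Type u) [Field F] [Algebra k F] (t : GTorsor G F), t.essentialDim k l ≤ d) :
    essentialDim k G l ≤ d :=
  iSup_le fun F => iSup_le fun _ => iSup_le fun _ => iSup_le fun t => h F t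

end EssentialDim

/-! ### Invariance under group isomorphism -/

section Congr

variable {k : Type u} [Field k] {l : ℕ}

/-- Transport of torsors along an isomorphism of groups. -/
abbrev GTorsor.congr {G : Type*} {G' : Type*} [Group G] [Group G'] (e : G' ≃* G)
    {F : Type u} [Field F] (t : GTorsor G F) : GTorsor G' F where
  carrier := t.carrier
  action := t.action.comp e.toMonoidHom
  bijective := by
    have : ⇑(torsorMap (t.action.comp e.toMonoidHom)) =
        (Equiv.piCongrLeft' (fun _ : G => t.carrier) e.symm.toEquiv) ∘ torsorMap t.action := by
      ext x g
      rfl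
    rw [this]
    exact (Equiv.bijective _).comp t.bijective

theorem essentialDim_le_of_mulEquiv {G : Type*} {G' : Type*} [Group G] [Group G'] (e : G' ≃* G) :
    essentialDim k G l ≤ essentialDim k G' l := by
  refine essentialDim_le fun F _ _ t => le_trans ?_ (t.congr e).essentialDim_le_essentialDim
  refine GTorsor.le_essentialDim _ fun F' _ _ _ _ _ hl E h => t.essentialDim_le F' hl E ?_
  obtain ⟨t', f, hf⟩ := h
  refine ⟨t'.congr e.symm, f, fun g x => ?_⟩
  have := hf (e.symm g) x
  simpa [GTorsor.baseChangeAction] using this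

theorem essentialDim_congr {G : Type*} {G' : Type*} [Group G] [Group G'] (e : G' ≃* G) :
    essentialDim k G l = essentialDim k G' l :=
  le_antisymm (essentialDim_le_of_mulEquiv e) (essentialDim_le_of_mulEquiv e.symm)

end Congr

/-! ### Subgroups do not increase essential dimension -/

section Subgroup

variable {k : Type u} [Field k] {G : Type u} [Group G] {H : Subgroup G}

/-- The image of `φ` is a form of `M`, but its `H`-invariants may exceed `E`. Enlarging `E` to these
invariants makes it Galois. -/
theorem exists_descent_of_equivariant [Finite G] {F' : Type u} [Field F'] [Algebra k F']
    (E : IntermediateField k F') (N : GTorsor G E) {M : Type u} [CommRing M] [Algebra F' M]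
    [Nontrivial M] {τ : H → M →ₐ[F'] M} (hτ : IsGaloisAction τ) (φ : N.carrier →+* M)
    (hφ : ∀ c : E, φ (algebraMap E N.carrier c) = algebraMap F' M c)
    (hφ' : ∀ (h : H) x, φ (N.action h x) = τ h (φ x)) :
    ∃ E' : IntermediateField k F', Algebra.trdeg k E' ≤ Algebra.trdeg k E ∧
      ∃ (N' : GTorsor H E') (e : M ≃ₐ[F'] (F' ⊗[E'] N'.carrier)),
        ∀ h x, e (τ h x) = N'.baseChangeAction F' h (e x) := by
  have hfin : Module.Finite E N.carrier := N.isGaloisAction.finite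
  have halg : ∀ x : F', algebraMap F' M x ∈ φ.range → IsAlgebraic E x := by
    rintro x ⟨y, hy⟩
    obtain ⟨p, hp, hpy⟩ := Algebra.IsIntegral.isIntegral (R := E) y
    refine IsIntegral.isAlgebraic ⟨p, hp, (algebraMap F' M).injective ?_⟩
    have hcomp : (algebraMap F' M).comp (algebraMap E F') = φ.comp (algebraMap E N.carrier) := by
      ext c; exact (hφ c).symm
    rw [Polynomial.hom_eval₂, hcomp, ← hy, ← Polynomial.hom_eval₂, hpy, map_zero, map_zero]
  -- The scalars lying in the image of `φ`. They are algebraic over `E`, as `N` is finite over `E`,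
  -- so they form a field.
  let S : Subalgebra E F' :=
    { φ.range.toSubsemiring.comap (algebraMap F' M) with
      algebraMap_mem' := fun c => ⟨algebraMap E N.carrier c, hφ c⟩ }
  let E' : IntermediateField k F' :=
    { S.restrictScalars k with
      inv_mem' := fun x hx => S.inv_mem_of_algebraic (x := ⟨x, hx⟩) (halg x hx) }
  have hmem : ∀ x, x ∈ E' ↔ algebraMap F' M x ∈ φ.range := fun x => Iff.rfl
  have hle : E ≤ E' := fun x hx => S.algebraMap_mem ⟨x, hx⟩
  refine ⟨E', ?_, ?_⟩
  · let : Algebra E E' := (IntermediateField.inclusion hle).toAlgebra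
    have : IsScalarTower k E E' := IsScalarTower.of_algebraMap_eq fun _ => rfl
    have : IsScalarTower E E' F' := IsScalarTower.of_algebraMap_eq fun _ => rfl
    have : Algebra.IsAlgebraic E E' := ⟨fun x => by
      rw [← isAlgebraic_algebraMap_iff (algebraMap E' F').injective]
      exact halg _ x.2⟩
    rw [← trdeg_add_eq k E (A := E'), trdeg_eq_zero (R := E), add_zero]
  let T : Subalgebra E' M :=
    { φ.range.toSubsemiring with
      algebraMap_mem' := fun c => c.2 }
  let ρ : H → T →ₐ[E'] T := fun h => (((τ h).restrictScalars E').comp T.val).codRestrict T (by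
    rintro ⟨x, y, rfl⟩
    exact ⟨N.action h y, hφ' h y⟩)
  have hρ : IsGaloisAction ρ :=
    { map_one := fun x => Subtype.ext (hτ.map_one _)
      map_mul := fun g h x => Subtype.ext (hτ.map_mul g h _)
      invariant := by
        intro x hx
        obtain ⟨c, hc⟩ := hτ.invariant x.1 fun g => congrArg Subtype.val (hx g)
        exact ⟨⟨c, (hmem c).2 (hc ▸ x.2)⟩, Subtype.ext hc⟩
      dual := by
        obtain ⟨ι, hι, a, b, hab, hab'⟩ := N.isGaloisAction.dual
        refine ⟨ι, hι, fun i => ⟨φ (a i), a i, rfl⟩, fun i => ⟨φ (b i), b i, rfl⟩, ?_, ?_⟩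
        · apply Subtype.ext
          have := congrArg φ hab
          simpa using this
        · intro h hh
          apply Subtype.ext
          have := congrArg φ (hab' h (by simpa using hh))
          simpa [ρ, hφ'] using this }
  let N' : GTorsor H E' := hρ.toGTorsor
  let f : F' ⊗[E'] N'.carrier →ₐ[F'] M :=
    Algebra.TensorProduct.lift (Algebra.ofId F' M) T.val (fun _ _ => Commute.all _ _)
  have hf : ∀ h x, f (N'.baseChangeAction F' h x) = τ h (f x) := by
    intro h x
    induction x with
    | zero => simp
    | add x y hx hy => simp only [map_add, hx, hy]
    | tmul x y =>
      simp [f, GTorsor.baseChangeAction]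
      rfl
  let e := AlgEquiv.ofBijective f
    ((N'.isGaloisAction_baseChange F').bijective_of_equivariant hτ f hf)
  refine ⟨N', e.symm, fun h x => ?_⟩
  apply e.injective
  have : ∀ y, e (N'.baseChangeAction F' h y) = τ h (e y) := hf h
  simp [this]

theorem essentialDim_subgroup_le [Finite G] (l : ℕ) :
    essentialDim k H l ≤ essentialDim k G l := by
  refine essentialDim_le fun F _ _ t => ?_
  have hind := isGaloisAction_induced t.isGaloisAction
  let s : GTorsor G F := hind.toGTorsor
  refine le_trans ?_ s.essentialDim_le_essentialDim
  refine s.le_essentialDim fun F' _ _ _ _ _ hl E ⟨N, e, he⟩ => ?_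
  -- Evaluation at `1` returns from the induced torsor to `t`, `H`-equivariantly.
  let q : F' ⊗[F] s.carrier →ₐ[F'] F' ⊗[F] t.carrier :=
    Algebra.TensorProduct.map (AlgHom.id F' F') (inducedEval _)
  have hq : ∀ (h : H) x, q (s.baseChangeAction F' h x) = t.baseChangeAction F' h (q x) := by
    intro h x
    induction x with
    | zero => simp
    | add x y hx hy => simp only [map_add, hx, hy]
    | tmul x y =>
      simp only [q, GTorsor.baseChangeAction, Algebra.TensorProduct.map_tmul, AlgHom.id_apply]
      congr 1
      exact inducedEval_equivariant _ h y
  let φ : N.carrier →+* F' ⊗[F] t.carrier :=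
    (q : F' ⊗[F] s.carrier →+* F' ⊗[F] t.carrier).comp
      ((e.symm : F' ⊗[E] N.carrier →+* F' ⊗[F] s.carrier).comp
        (Algebra.TensorProduct.includeRight : N.carrier →ₐ[E] F' ⊗[E] N.carrier).toRingHom)
  have hes : ∀ (g : G) x, e.symm (N.baseChangeAction F' g x) =
      s.baseChangeAction F' g (e.symm x) := fun g x => e.injective (by simp [he])
  obtain ⟨E', hE', N', e', he'⟩ := exists_descent_of_equivariant E N
    (t.isGaloisAction_baseChange F') φ (by
      intro c
      have : (1 : F') ⊗ₜ[E] algebraMap E N.carrier c = algebraMap F' _ (c : F') := by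
        rw [Algebra.algebraMap_eq_smul_one, TensorProduct.tmul_smul, TensorProduct.smul_tmul',
          Algebra.smul_def, mul_one]
        rfl
      change q (e.symm (1 ⊗ₜ algebraMap E N.carrier c)) = _
      rw [this, AlgEquiv.commutes, AlgHom.commutes]) (by
      intro h x
      change q (e.symm (1 ⊗ₜ N.action h x)) = t.baseChangeAction F' h (q (e.symm (1 ⊗ₜ x)))
      rw [← hq, ← hes]
      simp [GTorsor.baseChangeAction])
  exact (t.essentialDim_le F' hl E' ⟨N', e', he'⟩).trans (Cardinal.toENat.monotone' hE')

end Subgroup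

/-! ### Reduction of torsors to subgroups of index prime to `l` -/

section Reduction

variable {G : Type v} [Group G] {F : Type u} [Field F]

namespace GTorsor

/-- The subalgebra of invariants of a subgroup `H`. -/
def invariants (t : GTorsor G F) (H : Subgroup G) : Subalgebra F t.carrier where
  carrier := {x | ∀ h ∈ H, t.action h x = x}
  mul_mem' := by intro x y hx hy h hh; simp [hx h hh, hy h hh]
  add_mem' := by intro x y hx hy h hh; simp [hx h hh, hy h hh]
  algebraMap_mem' := by intro r h _; simp

theorem mem_invariants {t : GTorsor G F} {H : Subgroup G} {x : t.carrier} :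
    x ∈ t.invariants H ↔ ∀ h ∈ H, t.action h x = x := Iff.rfl

theorem trace_mem_invariants (t : GTorsor G F) (H : Subgroup G) [Fintype H] (x : t.carrier) :
    ∑ h : H, t.action h x ∈ t.invariants H := by
  intro h hh
  rw [map_sum]
  refine Fintype.sum_equiv (Equiv.mulLeft ⟨h, hh⟩) _ _ fun h' => ?_
  simp

/-- The map `L ⊗ L^H → ∏_{G/H} L`. -/
def quotientMap (t : GTorsor G F) (H : Subgroup G) :
    t.carrier ⊗[F] t.invariants H →ₗ[F] (G ⧸ H → t.carrier) :=
  LinearMap.pi fun s => (LinearMap.proj (Quotient.out s)).comp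
    ((torsorMap t.action).toLinearMap.comp
      ((t.invariants H).val.toLinearMap.lTensor t.carrier))

theorem quotientMap_tmul (t : GTorsor G F) (H : Subgroup G) (x : t.carrier)
    (y : t.invariants H) (s : G ⧸ H) :
    t.quotientMap H (x ⊗ₜ y) s = x * t.action (Quotient.out s) y.1 := by
  simp [quotientMap, torsorMap_tmul]

theorem torsorMap_lTensor_eq_quotientMap (t : GTorsor G F) (H : Subgroup G)
    (z : t.carrier ⊗[F] t.invariants H) (g : G) :
    torsorMap t.action ((t.invariants H).val.toLinearMap.lTensor t.carrier z) g =
      t.quotientMap H z (g : G ⧸ H) := by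
  induction z with
  | zero => simp
  | add x y hx hy => simp only [map_add, Pi.add_apply, hx, hy]
  | tmul x y =>
    obtain ⟨h, hh⟩ := QuotientGroup.mk_out_eq_mul H g
    rw [quotientMap_tmul, hh]
    simp [torsorMap_tmul, mem_invariants.1 y.2 h h.2]

/-- Injectivity is inherited from the torsor map by flatness. Traces over `H` of translates of the
`b i` yield preimages. -/
theorem bijective_quotientMap [Finite G] (t : GTorsor G F) (H : Subgroup G) :
    Function.Bijective (t.quotientMap H) := by
  classical
  constructor
  · rw [injective_iff_map_eq_zero]
    intro z hz
    apply Module.Flat.lTensor_preserves_injective_linearMap (M := t.carrier)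
      (t.invariants H).val.toLinearMap Subtype.val_injective
    apply t.bijective.1
    ext g
    rw [torsorMap_lTensor_eq_quotientMap, hz]
    simp
  · intro u
    have := Fintype.ofFinite G
    have := Fintype.ofFinite (G ⧸ H)
    have := Fintype.ofFinite H
    obtain ⟨ι, _, a, b, hab, hab'⟩ := t.isGaloisAction.dual
    refine ⟨∑ s, ∑ i, (u s * a i) ⊗ₜ
      ⟨_, t.trace_mem_invariants H (t.action (Quotient.out s)⁻¹ (b i))⟩, ?_⟩
    ext s
    simp only [map_sum, Finset.sum_apply, quotientMap_tmul, mul_assoc, ← Finset.mul_sum]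
    have key : ∀ s' : G ⧸ H, ∑ i, a i * ∑ h : H, t.action (Quotient.out s)
        (t.action h (t.action (Quotient.out s')⁻¹ (b i))) = if s' = s then 1 else 0 := by
      intro s'
      simp only [Finset.mul_sum]
      rw [Finset.sum_comm]
      have h1 : ∀ h : H, ∑ i, a i * t.action (Quotient.out s)
          (t.action h (t.action (Quotient.out s')⁻¹ (b i))) =
          if (Quotient.out s) * h * (Quotient.out s')⁻¹ = 1 then 1 else 0 := by
        intro h
        simp only [← AlgEquiv.mul_apply, ← map_mul, ← mul_assoc]
        split_ifs with hh
        · simpa only [hh, map_one, AlgEquiv.one_apply] using hab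
        · exact hab' _ hh
      simp only [h1]
      by_cases hs : s' = s
      · subst hs
        rw [if_pos rfl, Finset.sum_eq_single 1]
        · simp
        · intro h _ hh
          rw [if_neg]
          simpa [mul_inv_eq_one] using hh
        · simp
      · rw [if_neg hs]
        refine Finset.sum_eq_zero fun h _ => if_neg fun hh => hs ?_
        rw [mul_inv_eq_one] at hh
        rw [← QuotientGroup.out_eq' s, ← QuotientGroup.out_eq' s', eq_comm, QuotientGroup.eq, ← hh]
        simp
    simp only [key, mul_ite, mul_one, mul_zero, Finset.sum_ite_eq',
      Finset.mem_univ, if_true]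

theorem finrank_invariants [Finite G] (t : GTorsor G F) (H : Subgroup G) :
    Module.finrank F (t.invariants H) = H.index := by
  have := Fintype.ofFinite (G ⧸ H)
  have : Module.Finite F t.carrier := t.isGaloisAction.finite
  have h := (LinearEquiv.ofBijective _ (t.bijective_quotientMap H)).finrank_eq
  rw [Module.finrank_tensorProduct, Module.finrank_pi_fintype] at h
  simp only [Finset.sum_const, Finset.card_univ, smul_eq_mul] at h
  rw [Subgroup.index, Nat.card_eq_fintype_card]
  exact Nat.eq_of_mul_eq_mul_left Module.finrank_pos (h.trans (mul_comm _ _))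

/-- The trace over `G` factors as the trace over `H` of a sum over inverse coset representatives. -/
theorem exists_trace_subgroup_eq_one [Finite G] (t : GTorsor G F) (H : Subgroup G) [Fintype H] :
    ∃ c : t.carrier, ∑ h : H, t.action h c = 1 := by
  have := Fintype.ofFinite G
  have := Fintype.ofFinite (G ⧸ H)
  obtain ⟨c, hc⟩ := t.isGaloisAction.exists_trace_eq_one
  refine ⟨∑ s : G ⧸ H, t.action (Quotient.out s)⁻¹ c, ?_⟩
  rw [← hc]
  simp only [map_sum]
  rw [Finset.sum_comm, ← Fintype.sum_prod_type']
  let e : (G ⧸ H) × H → G := fun p => p.2 * (Quotient.out p.1)⁻¹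
  have he : Function.Bijective e := by
    constructor
    · rintro ⟨s, h⟩ ⟨s', h'⟩ hh
      have hh' : (h : G) * (Quotient.out s)⁻¹ = h' * (Quotient.out s')⁻¹ := hh
      have hs : s = s' := by
        rw [← QuotientGroup.out_eq' s, ← QuotientGroup.out_eq' s', eq_comm, QuotientGroup.eq]
        have : (Quotient.out s')⁻¹ * Quotient.out s = (h' : G)⁻¹ * h := by
          rw [eq_inv_mul_iff_mul_eq, ← mul_assoc, ← hh']; simp
        rw [this]
        exact H.mul_mem (H.inv_mem h'.2) h.2
      subst hs
      simpa using hh'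
    · intro g
      obtain ⟨h, hh⟩ := QuotientGroup.mk_out_eq_mul H g⁻¹
      exact ⟨⟨(g⁻¹ : G), h⟩, by simp only [e]; rw [hh]; simp⟩
  exact Fintype.sum_bijective e he _ _ fun p => by simp [e]

/-- The invariants are reduced and Artinian, hence a product of their residue fields, whose degrees
add up to the index. -/
theorem exists_maximalIdeal_invariants [Finite G] (t : GTorsor G F) (H : Subgroup G) {l : ℕ}
    (hl : ¬ l ∣ H.index) : ∃ I : Ideal (t.invariants H), I.IsMaximal ∧
      ¬ l ∣ Module.finrank F (t.invariants H ⧸ I) := by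
  have : Module.Finite F t.carrier := t.isGaloisAction.finite
  have : IsReduced t.carrier := t.isGaloisAction.isReduced
  have : IsReduced (t.invariants H) :=
    isReduced_of_injective (t.invariants H).val Subtype.val_injective
  have : IsArtinianRing (t.invariants H) := IsArtinianRing.of_finite F _
  have := Fintype.ofFinite (MaximalSpectrum (t.invariants H))
  by_contra! hne
  apply hl
  rw [← t.finrank_invariants H,
    ((IsArtinianRing.equivPi (t.invariants H)).restrictScalars F).toLinearEquiv.finrank_eq,
    Module.finrank_pi_fintype]
  exact Finset.dvd_sum fun I _ => hne _ I.isMaximal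

/-- Over some extension of degree prime to `l`, a `G`-torsor reduces to a subgroup of index prime
to `l`. -/
theorem exists_reduction [Finite G] (t : GTorsor G F) (H : Subgroup G) {l : ℕ}
    (hl : ¬ l ∣ H.index) : ∃ (F₁ : Type u) (_ : Field F₁) (_ : Algebra F F₁),
      FiniteDimensional F F₁ ∧ ¬ l ∣ Module.finrank F F₁ ∧
      ∃ (s : GTorsor H F₁) (φ : t.carrier →+* s.carrier),
        (∀ c : F, φ (algebraMap F _ c) = algebraMap F₁ _ (algebraMap F F₁ c)) ∧
        ∀ (h : H) x, φ (t.action h x) = s.action h (φ x) := by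
  have := Fintype.ofFinite H
  have : Module.Finite F t.carrier := t.isGaloisAction.finite
  obtain ⟨I, hI, hIl⟩ := t.exists_maximalIdeal_invariants H hl
  let A := t.invariants H
  -- The reduction is the fibre over the closed point `I`. It is nonzero by lying over.
  let J : Ideal t.carrier := I.map (algebraMap A t.carrier)
  let M := t.carrier ⧸ J
  let : Field (A ⧸ I) := Ideal.Quotient.field I
  have hM : Nontrivial M := by
    have : Algebra.IsIntegral A t.carrier := Algebra.IsIntegral.tower_top F
    obtain ⟨Q, hQ, hQI⟩ := Ideal.exists_ideal_over_maximal_of_isIntegral (S := t.carrier) I (by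
      rw [(RingHom.injective_iff_ker_eq_bot _).1 (Subtype.val_injective :
        Function.Injective (algebraMap A t.carrier))]
      exact bot_le)
    rw [Ideal.Quotient.nontrivial_iff]
    exact fun h => hQ.ne_top (top_unique (h ▸ Ideal.map_le_iff_le_comap.2 hQI.ge))
  have hJ : ∀ h : H, J ≤ J.comap (t.action h : t.carrier →+* t.carrier) := by
    intro h
    rw [Ideal.map_le_iff_le_comap]
    intro a ha
    have : t.action h (a : t.carrier) = a := a.2 h h.2
    simp only [Ideal.mem_comap]
    change t.action h (a : t.carrier) ∈ J
    rw [this]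
    exact Ideal.mem_map_of_mem _ ha
  let ρ : H → M →ₐ[A ⧸ I] M := fun h =>
    { Ideal.quotientMap J (t.action h : t.carrier →+* t.carrier) (hJ h) with
      commutes' := by
        intro a
        obtain ⟨a, rfl⟩ := Ideal.Quotient.mk_surjective a
        exact congrArg (Ideal.Quotient.mk J) (a.2 h h.2) }
  have hρmk : ∀ h x, ρ h (Ideal.Quotient.mk J x) = Ideal.Quotient.mk J (t.action h x) :=
    fun h x => rfl
  have hρ : IsGaloisAction ρ :=
    { map_one := fun x => by
        obtain ⟨x, rfl⟩ := Ideal.Quotient.mk_surjective x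
        simp [hρmk]
      map_mul := fun g h x => by
        obtain ⟨x, rfl⟩ := Ideal.Quotient.mk_surjective x
        simp [hρmk]
      invariant := by
        intro x hx
        obtain ⟨x, rfl⟩ := Ideal.Quotient.mk_surjective x
        -- Multiplying by `c` and taking the `H`-trace lifts an invariant class to a genuine
        -- invariant.
        obtain ⟨c, hc⟩ := t.exists_trace_subgroup_eq_one H
        refine ⟨Ideal.Quotient.mk I ⟨_, t.trace_mem_invariants H (c * x)⟩, ?_⟩
        change Ideal.Quotient.mk J (∑ h : H, t.action h (c * x)) = _
        simp only [map_mul, map_sum, ← hρmk, hx, ← Finset.sum_mul]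
        simp only [hρmk, ← map_sum, hc, map_one, one_mul]
      dual := by
        obtain ⟨ι, hι, a, b, hab, hab'⟩ := t.isGaloisAction.dual
        refine ⟨ι, hι, fun i => Ideal.Quotient.mk J (a i), fun i => Ideal.Quotient.mk J (b i),
          ?_, fun h hh => ?_⟩
        · simp only [← map_mul, ← map_sum, hab, map_one]
        · have := congrArg (Ideal.Quotient.mk J) (hab' h (by simpa using hh))
          simpa [hρmk] using this }
  exact ⟨A ⧸ I, inferInstance, inferInstance, inferInstance, hIl, hρ.toGTorsor,
    Ideal.Quotient.mk J, fun c => rfl, fun h x => rfl⟩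

end GTorsor

end Reduction

/-! ### Equality for subgroups of index prime to `l` -/

section SubgroupOfCoprimeIndex

variable {k : Type u} [Field k] {l : ℕ}

theorem essentialDim_le_essentialDim_subgroup {G : Type u} [Group G] [Finite G] {H : Subgroup G}
    (hp : l.Prime) (hl : ¬ l ∣ H.index) : essentialDim k G l ≤ essentialDim k H l := by
  refine essentialDim_le fun F _ _ t => ?_
  obtain ⟨F₁, _, _, hfin, hF₁, s, φ, hφ, hφ'⟩ := t.exists_reduction H hl
  let : Algebra k F₁ := ((algebraMap F F₁).comp (algebraMap k F)).toAlgebra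
  have : IsScalarTower k F F₁ := IsScalarTower.of_algebraMap_eq fun _ => rfl
  refine le_trans ?_ s.essentialDim_le_essentialDim
  refine s.le_essentialDim fun F' _ _ _ _ _ hF' E ⟨N, e, he⟩ => ?_
  let : Algebra F F' := ((algebraMap F₁ F').comp (algebraMap F F₁)).toAlgebra
  have : IsScalarTower F F₁ F' := IsScalarTower.of_algebraMap_eq fun _ => rfl
  have : IsScalarTower k F F' := IsScalarTower.of_algebraMap_eq fun c => by
    rw [IsScalarTower.algebraMap_apply k F₁ F', IsScalarTower.algebraMap_apply k F F₁]
    rfl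
  have : FiniteDimensional F F' := FiniteDimensional.trans F F₁ F'
  refine t.essentialDim_le F' ?_ E ?_
  · rw [← Module.finrank_mul_finrank F F₁ F', hp.dvd_mul]
    exact not_or.2 ⟨hF₁, hF'⟩
  -- The torsor induced from `N` and `t` itself both map `H`-equivariantly to `F' ⊗ N` over `F'`, so
  -- they become isomorphic there.
  have hind := isGaloisAction_induced N.isGaloisAction
  let N' : GTorsor G E := hind.toGTorsor
  let φ' : t.carrier →ₐ[F] F' ⊗[F₁] s.carrier :=
    { (Algebra.TensorProduct.includeRight : s.carrier →ₐ[F₁] F' ⊗[F₁] s.carrier).toRingHom.comp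
        φ with
      commutes' := fun c => by
        change (1 : F') ⊗ₜ[F₁] φ (algebraMap F t.carrier c) = algebraMap F F' c ⊗ₜ 1
        rw [hφ, Algebra.algebraMap_eq_smul_one (A := s.carrier), TensorProduct.tmul_smul,
          TensorProduct.smul_tmul', Algebra.smul_def, mul_one]
        rfl }
  let f : F' ⊗[F] t.carrier →ₐ[F'] F' ⊗[E] N.carrier :=
    (e : F' ⊗[F₁] s.carrier →ₐ[F'] F' ⊗[E] N.carrier).comp
      (Algebra.TensorProduct.lift (Algebra.ofId F' _) φ' fun _ _ => Commute.all _ _)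
  let f' : F' ⊗[E] N'.carrier →ₐ[F'] F' ⊗[E] N.carrier :=
    Algebra.TensorProduct.map (AlgHom.id F' F') (inducedEval _)
  obtain ⟨e', he'⟩ := exists_algEquiv_of_equivariant (N.isGaloisAction_baseChange F')
    (t.isGaloisAction_baseChange F') f (by
      intro h x
      induction x with
      | zero => simp
      | add x y hx hy => simp only [map_add, hx, hy]
      | tmul x y =>
        have h1 : φ' (t.action h y) = s.baseChangeAction F' h (φ' y) := by
          change (1 : F') ⊗ₜ[F₁] φ (t.action h y) = s.baseChangeAction F' h (1 ⊗ₜ φ y)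
          simp [GTorsor.baseChangeAction, hφ']
        have h2 : t.baseChangeAction F' h (x ⊗ₜ y) = x ⊗ₜ t.action h y := by
          simp [GTorsor.baseChangeAction]
        have h3 : ∀ z, f (x ⊗ₜ z) = e (algebraMap F' _ x * φ' z) := fun z => by
          simp only [f, AlgHom.comp_apply, Algebra.TensorProduct.lift_tmul]
          rfl
        rw [h2, h3, h3, ← he, map_mul (s.baseChangeAction F' h), AlgHom.commutes, h1])
    (N'.isGaloisAction_baseChange F') f' (by
      intro h x
      induction x with
      | zero => simp
      | add x y hx hy => simp only [map_add, hx, hy]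
      | tmul x y =>
        simp only [f', GTorsor.baseChangeAction, Algebra.TensorProduct.map_tmul, AlgHom.id_apply]
        congr 1
        exact inducedEval_equivariant _ h y)
  exact ⟨N', e', he'⟩

/-- The essential `l`-dimension does not change when passing to a subgroup of index prime to `l`. -/
theorem essentialDim_eq_of_injective {H : Type*} {G : Type*} [Group H] [Group G] [Finite G]
    (f : H →* G) (hf : Function.Injective f) (hp : l.Prime) (hl : ¬ l ∣ f.range.index) :
    essentialDim k H l = essentialDim k G l := by
  -- The induced algebra consists of functions on the group, so the group is moved to the universe
  -- of `k`.
  have : Small.{u} G := Countable.toSmall G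
  let e : G ≃* Shrink.{u} G := (Shrink.mulEquiv.{u} (α := G)).symm
  have : Finite (Shrink.{u} G) := Finite.of_equiv _ e.toEquiv
  let S : Subgroup (Shrink.{u} G) := f.range.map e.toMonoidHom
  have hS : S.index = f.range.index := by
    rw [Subgroup.index_map_of_bijective]; exact e.bijective
  let e' : H ≃* S := (MonoidHom.ofInjective hf).trans (e.subgroupMap f.range)
  rw [← essentialDim_congr e', ← essentialDim_congr e]
  exact le_antisymm (essentialDim_subgroup_le l)
    (essentialDim_le_essentialDim_subgroup hp (hS ▸ hl))

end SubgroupOfCoprimeIndex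

/-! ### Orthonormal bases of Hermitian forms -/

section Hermitian

variable {K : Type*} [Field K] {n : ℕ} (σ : K →+* K) (β : Matrix (Fin n) (Fin n) K)

/-- The sesquilinear form `(x, y) ↦ xᵀ β (σ y)`. -/
def sesqForm (x y : Fin n → K) : K := x ⬝ᵥ (β *ᵥ (σ ∘ y))

theorem sesqForm_add_left (x x' y : Fin n → K) :
    sesqForm σ β (x + x') y = sesqForm σ β x y + sesqForm σ β x' y := by
  simp [sesqForm]

theorem sesqForm_smul_left (c : K) (x y : Fin n → K) :
    sesqForm σ β (c • x) y = c * sesqForm σ β x y := by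
  simp [sesqForm]

variable {σ β}

theorem sesqForm_swap (hσ : ∀ x, σ (σ x) = x) (hβ : βᵀ = β.map σ) (x y : Fin n → K) :
    sesqForm σ β y x = σ (sesqForm σ β x y) := by
  have h1 : σ (sesqForm σ β x y) = (σ ∘ x) ⬝ᵥ ((β.map σ) *ᵥ (σ ∘ σ ∘ y)) := by
    simp only [sesqForm]
    rw [RingHom.map_dotProduct]
    congr 1
    ext i
    simp [RingHom.map_mulVec]
  have h2 : σ ∘ σ ∘ y = y := by ext i; simp [hσ]
  rw [h1, h2, ← hβ, Matrix.mulVec_transpose, dotProduct_comm, ← Matrix.dotProduct_mulVec]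
  rfl

theorem exists_sesqForm_ne_zero (hβ : IsUnit β.det) {w : Fin n → K} (hw : w ≠ 0) :
    ∃ x, sesqForm σ β x w ≠ 0 := by
  by_contra! h
  have h0 : β *ᵥ (σ ∘ w) = 0 := dotProduct_eq_zero _ fun x => by
    rw [dotProduct_comm]; exact h x
  have h1 := Matrix.eq_zero_of_mulVec_eq_zero hβ.ne_zero h0
  exact hw (funext fun i => by simpa using congrFun h1 i)

/-- Over a field with an involution `σ` whose norm map is surjective onto its fixed elements, a
nondegenerate Hermitian form has orthonormal families of every size up to the dimension. -/
theorem exists_orthonormal (hσ : ∀ x, σ (σ x) = x) (htr : ∃ d, d + σ d ≠ 0)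
    (hnorm : ∀ a, a ≠ 0 → σ a = a → ∃ c, c * σ c = a) (hβ : IsUnit β.det) (hherm : βᵀ = β.map σ) :
    ∀ m ≤ n, ∃ v : Fin m → Fin n → K, ∀ i j, sesqForm σ β (v i) (v j) = if i = j then 1 else 0 := by
  have hswap := sesqForm_swap hσ hherm
  have hadd := sesqForm_add_left σ β
  have hsmul := sesqForm_smul_left σ β
  have hadd' : ∀ x y y', sesqForm σ β x (y + y') = sesqForm σ β x y + sesqForm σ β x y' := by
    intro x y y'; rw [hswap, hadd, map_add, ← hswap, ← hswap]
  have hsmul' : ∀ c x y, sesqForm σ β x (c • y) = σ c * sesqForm σ β x y := by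
    intro c x y; rw [hswap, hsmul, map_mul, ← hswap]
  intro m
  induction m with
  | zero => exact fun _ => ⟨Fin.elim0, fun i => i.elim0⟩
  | succ m ih =>
    intro hm
    obtain ⟨v, hv⟩ := ih (by omega)
    let f : (Fin n → K) →ₗ[K] (Fin m → K) :=
      { toFun := fun x i => sesqForm σ β x (v i)
        map_add' := fun x y => by ext i; simp [hadd]
        map_smul' := fun c x => by ext i; simp [hsmul] }
    have hf : ∀ x i, f x i = sesqForm σ β x (v i) := fun _ _ => rfl
    obtain ⟨w, hw, hw0⟩ := (Submodule.ne_bot_iff _).1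
      (LinearMap.ker_ne_bot_of_finrank_lt (f := f) (by simp; omega))
    have hwv : ∀ i, sesqForm σ β w (v i) = 0 := fun i => congrFun hw i
    -- The orthogonal complement of the `v i` contains an anisotropic vector; otherwise polarization
    -- contradicts `htr`.
    have hex : ∃ z, (∀ i, sesqForm σ β z (v i) = 0) ∧ sesqForm σ β z z ≠ 0 := by
      by_contra! hz
      obtain ⟨x, hx⟩ := exists_sesqForm_ne_zero (σ := σ) hβ hw0
      -- Projection to the complement does not change the pairing with `w`.
      let x' := x - ∑ i, sesqForm σ β x (v i) • v i
      have hfv : ∀ i, f (v i) = Pi.single i 1 := fun i => by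
        ext j; simp [hf, hv, Pi.single_apply, eq_comm]
      have hx'v : f x' = 0 := by
        have hcongr : ∑ i, sesqForm σ β x (v i) • (Pi.single i 1 : Fin m → K) = f x := by
          ext j
          simp [Finset.sum_apply, Pi.single_apply, hf]
        simp only [x', map_sub, map_sum, map_smul, hfv, hcongr, sub_self]
      have hvw : ∀ i, sesqForm σ β (v i) w = 0 := fun i => by rw [hswap, hwv, map_zero]
      let g : (Fin n → K) →ₗ[K] K :=
        { toFun := fun x => sesqForm σ β x w
          map_add' := fun x y => hadd x y w
          map_smul' := fun c x => hsmul c x w }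
      have hx'w : sesqForm σ β x' w = sesqForm σ β x w := by
        change g x' = g x
        have : ∀ i, g (v i) = 0 := hvw
        simp [x', this]
      set a := sesqForm σ β x w
      obtain ⟨d, hd⟩ := htr
      have hww := hz w hwv
      have hx'x' := hz x' fun i => congrFun hx'v i
      -- The factor `d / a` makes the pairing with `w` equal to `d`, so the form takes the value `d
      -- + σ d` here.
      have hsum := hz ((d / a) • x' + w) fun i => by
        rw [hadd, hsmul, hwv, ← hf, hx'v]; simp
      rw [hadd, hadd', hadd', hsmul, hsmul, hsmul', hsmul', hww, hx'x', hswap x' w, hx'w,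
        ← map_mul, div_mul_cancel₀ _ hx] at hsum
      exact hd (by simpa using hsum)
    obtain ⟨z, hzv, hzz⟩ := hex
    obtain ⟨c, hc⟩ := hnorm _ hzz (hswap z z).symm
    have hc0 : c ≠ 0 := by rintro rfl; exact hzz (by rw [← hc, zero_mul])
    have hvz : ∀ i, sesqForm σ β (v i) z = 0 := fun i => by rw [hswap, hzv, map_zero]
    refine ⟨Fin.cons (c⁻¹ • z) v, fun i j => ?_⟩
    refine Fin.cases ?_ (fun i => ?_) i <;> refine Fin.cases ?_ (fun j => ?_) j
    · rw [Fin.cons_zero, hsmul, hsmul', ← hc, if_pos rfl, map_inv₀]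
      have : σ c ≠ 0 := by simpa using hc0
      field_simp
    · rw [Fin.cons_zero, Fin.cons_succ, hsmul, hzv, mul_zero, if_neg (Fin.succ_ne_zero j).symm]
    · rw [Fin.cons_zero, Fin.cons_succ, hsmul', hvz, mul_zero, if_neg (Fin.succ_ne_zero i)]
    · rw [Fin.cons_succ, Fin.cons_succ, hv]
      simp

/-- A nondegenerate Hermitian matrix is congruent to the identity matrix. -/
theorem exists_transpose_mul_map_eq (hσ : ∀ x, σ (σ x) = x) (htr : ∃ d, d + σ d ≠ 0)
    (hnorm : ∀ a, a ≠ 0 → σ a = a → ∃ c, c * σ c = a) (hβ : IsUnit β.det) (hherm : βᵀ = β.map σ) :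
    ∃ P : GL (Fin n) K, (P : Matrix (Fin n) (Fin n) K)ᵀ *
      (P : Matrix (Fin n) (Fin n) K).map σ = β := by
  obtain ⟨v, hv⟩ := exists_orthonormal hσ htr hnorm hβ hherm n le_rfl
  let V : Matrix (Fin n) (Fin n) K := (Matrix.of v)ᵀ
  have hV : Vᵀ * β * V.map σ = 1 := by
    ext i j
    rw [Matrix.one_apply, ← hv i j, Matrix.mul_assoc]
    rfl
  have hdet : IsUnit V.det := by
    have := congrArg Matrix.det hV
    rw [Matrix.det_mul, Matrix.det_mul, Matrix.det_transpose, Matrix.det_one, mul_assoc] at this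
    exact IsUnit.of_mul_eq_one _ this
  let W := (Matrix.GeneralLinearGroup.mk'' V hdet)
  have h1 : V * (W⁻¹ : GL (Fin n) K).1 = 1 := W.mul_inv
  refine ⟨W⁻¹, ?_⟩
  calc _ = (W⁻¹ : GL (Fin n) K).1ᵀ * (Vᵀ * β * V.map σ) * (W⁻¹ : GL (Fin n) K).1.map σ := by
        rw [hV, Matrix.mul_one]
    _ = (V * (W⁻¹ : GL (Fin n) K).1)ᵀ * β * (V * (W⁻¹ : GL (Fin n) K).1).map σ := by
        simp only [Matrix.transpose_mul, Matrix.map_mul, Matrix.mul_assoc]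
    _ = β := by rw [h1]; simp

end Hermitian

/-! ### Trace and norm of the quadratic extension of finite fields -/

section FiniteField

theorem one_lt_of_card_eq {K : Type*} [Field K] [Finite K] {p r : ℕ} (hK : Nat.card K = (p ^ r) ^ 2) : 1 < p ^ r := by
  have := Finite.one_lt_card (α := K)
  rw [hK] at this
  exact lt_of_pow_lt_pow_left₀ 2 (Nat.zero_le _) (by simpa using this)

theorem card_units_eq {K : Type*} [Field K] {p r : ℕ} (hK : Nat.card K = (p ^ r) ^ 2) :
    Nat.card Kˣ = (p ^ r - 1) * (p ^ r + 1) := by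
  rw [Nat.card_units, hK, mul_comm, ← Nat.sq_sub_sq, one_pow]

variable {K : Type*} [Field K] [Finite K] {p r : ℕ} [Fact p.Prime] [CharP K p]

theorem iterateFrobenius_involutive (hK : Nat.card K = (p ^ r) ^ 2) (x : K) :
    iterateFrobenius K p r (iterateFrobenius K p r x) = x := by
  have := Fintype.ofFinite K
  rw [iterateFrobenius_def, iterateFrobenius_def, ← pow_mul, ← sq, ← hK, Nat.card_eq_fintype_card,
    FiniteField.pow_card]

/-- Otherwise `d = 1` gives `1 = -1`, so Frobenius fixes a generator of the units, whose order q² -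
1 would divide q - 1. -/
theorem exists_add_iterateFrobenius_ne_zero (hK : Nat.card K = (p ^ r) ^ 2) :
    ∃ d : K, d + iterateFrobenius K p r d ≠ 0 := by
  by_contra! h
  have hq := one_lt_of_card_eq hK
  obtain ⟨g, hg⟩ := IsCyclic.exists_ofOrder_eq_natCard (α := Kˣ)
  have h2 : (1 : K) = -1 := eq_neg_of_add_eq_zero_left (by simpa using h 1)
  have h3 : (g : K) ^ (p ^ r) = g := by
    have := h g
    rw [iterateFrobenius_def] at this
    rw [eq_neg_of_add_eq_zero_right this, neg_eq_neg_one_mul, ← h2, one_mul]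
  have h4 : g ^ (p ^ r - 1) = 1 := by
    apply mul_right_cancel (b := g)
    rw [← pow_succ, Nat.sub_add_cancel hq.le, one_mul]
    exact Units.ext (by simpa using h3)
  have h5 := orderOf_dvd_of_pow_eq_one h4
  rw [hg, card_units_eq hK] at h5
  have := Nat.le_of_dvd (by omega) h5
  nlinarith [Nat.sub_add_cancel hq.le]

/-- If `g` generates the units and `g ^ s` is fixed, then q + 1 divides `s`, and `g ^ (s / (q + 1))`
has norm `g ^ s`. -/
theorem exists_mul_iterateFrobenius_eq (hK : Nat.card K = (p ^ r) ^ 2) (a : K) (ha : a ≠ 0)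
    (hfix : iterateFrobenius K p r a = a) : ∃ c, c * iterateFrobenius K p r c = a := by
  have hq := one_lt_of_card_eq hK
  obtain ⟨g, hg⟩ := IsCyclic.exists_generator (α := Kˣ)
  have hord : orderOf g = Nat.card Kˣ := orderOf_eq_card_of_forall_mem_zpowers hg
  obtain ⟨s, hs⟩ := (mem_powers_iff_mem_zpowers.2 (hg (Units.mk0 a ha)) : _ ∈ Submonoid.powers g)
  have hs' : g ^ s = Units.mk0 a ha := hs
  have h1 : (Units.mk0 a ha) ^ (p ^ r - 1) = 1 := by
    apply mul_right_cancel (b := Units.mk0 a ha)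
    rw [← pow_succ, Nat.sub_add_cancel hq.le, one_mul]
    exact Units.ext (by simpa [iterateFrobenius_def] using hfix)
  rw [← hs', ← pow_mul] at h1
  have h2 := orderOf_dvd_of_pow_eq_one h1
  rw [hord, card_units_eq hK, mul_comm s] at h2
  obtain ⟨d, rfl⟩ := Nat.dvd_of_mul_dvd_mul_left (by omega) h2
  refine ⟨((g ^ d : Kˣ) : K), ?_⟩
  rw [iterateFrobenius_def, ← pow_succ']
  have := congrArg Units.val hs'
  rw [Units.val_mk0] at this
  rw [← this, mul_comm, pow_mul]
  simp

end FiniteField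

/-! ### Monomial matrices -/

section Monomial

variable {K : Type*} [Field K] {n : ℕ} (μ : Subgroup Kˣ)

/-- The representation of the wreath product of `μ` and the symmetric group by monomial
matrices. -/
def monomialHom :
    ((Fin n → μ) ⋊[mulAutArrow] Equiv.Perm (Fin n)) →* Matrix (Fin n) (Fin n) K where
  toFun x := Matrix.of fun i j => if i = x.right j then ((x.left i : Kˣ) : K) else 0
  map_one' := by
    ext i j
    rcases eq_or_ne i j with rfl | h
    · rw [Matrix.one_apply_eq]
      exact if_pos rfl
    · rw [Matrix.one_apply_ne h]
      exact if_neg h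
  map_mul' x y := by
    ext i j
    rw [Matrix.mul_apply, Finset.sum_eq_single (y.right j)]
    · by_cases h : i = x.right (y.right j)
      · subst h
        simp only [Matrix.of_apply, if_true]
        rw [if_pos (by simp)]
        have h : (x * y).left (x.right (y.right j)) =
            x.left (x.right (y.right j)) * y.left (x.right.symm (x.right (y.right j))) := rfl
        rw [h, Equiv.symm_apply_apply, Subgroup.coe_mul, Units.val_mul]
      · simp [h]
    · intro k _ hk
      simp [hk]
    · simp

theorem monomialHom_apply (x : (Fin n → μ) ⋊[mulAutArrow] Equiv.Perm (Fin n)) (i j : Fin n) :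
    monomialHom μ x i j = if i = x.right j then ((x.left i : Kˣ) : K) else 0 := rfl

theorem monomialHom_injective : Function.Injective (monomialHom (n := n) μ) := by
  rw [injective_iff_map_eq_one]
  intro x hx
  have h : ∀ i j, (if i = x.right j then ((x.left i : Kˣ) : K) else 0) =
      (1 : Matrix (Fin n) (Fin n) K) i j := fun i j => by rw [← hx]; rfl
  have hr : x.right = 1 := by
    ext1 j
    by_contra hj
    have := h (x.right j) j
    rw [if_pos rfl, Matrix.one_apply_ne (show x.right j ≠ j from hj)] at this
    exact Units.ne_zero _ this
  refine SemidirectProduct.ext ?_ hr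
  ext i
  have := h i i
  simpa [hr] using this

theorem monomialHom_unitary (σ : K →+* K) (hμ : ∀ x ∈ μ, (x : K) * σ x = 1)
    (x : (Fin n → μ) ⋊[mulAutArrow] Equiv.Perm (Fin n)) :
    (monomialHom μ x)ᵀ * (monomialHom μ x).map σ = 1 := by
  ext i j
  rw [Matrix.mul_apply, Finset.sum_eq_single (x.right i)]
  · by_cases h : i = j
    · subst h
      simpa [monomialHom_apply] using hμ _ (x.left (x.right i)).2
    · simp [monomialHom_apply, h]
  · intro k _ hk
    simp [monomialHom_apply, hk]
  · simp

theorem card_wreathProduct : Nat.card ((Fin n → μ) ⋊[mulAutArrow] Equiv.Perm (Fin n)) =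
    Nat.card μ ^ n * n.factorial := by
  rw [SemidirectProduct.card]
  rw [Nat.card_perm, Nat.card_fun, Nat.card_fin]

end Monomial

/-! ### The index of the unitary group in GL -/

section Index

variable {n : ℕ}

/-- Conjugation by `P` carries the monomial matrices, unitary for the identity form, into this
unitary group. -/
theorem pow_mul_factorial_dvd_card_matUnitary {K : Type*} [Field K] (μ : Subgroup Kˣ)
    (σ : K →+* K) (hμ : ∀ x ∈ μ, (x : K) * σ x = 1)
    (P : GL (Fin n) K) : Nat.card μ ^ n * n.factorial ∣
      Nat.card (matUnitary σ ((P : Matrix (Fin n) (Fin n) K)ᵀ *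
        (P : Matrix (Fin n) (Fin n) K).map σ)) := by
  rw [← card_wreathProduct]
  let f : ((Fin n → μ) ⋊[mulAutArrow] Equiv.Perm (Fin n)) →* GL (Fin n) K :=
    (MulAut.conj P⁻¹).toMonoidHom.comp (monomialHom μ).toHomUnits
  have hf : ∀ x, f x = P⁻¹ * (monomialHom μ).toHomUnits x * P := fun x => by
    simp [f]
  have hmem : ∀ x, f x ∈ matUnitary σ ((P : Matrix (Fin n) (Fin n) K)ᵀ *
        (P : Matrix (Fin n) (Fin n) K).map σ) := by
    intro x
    have hx := monomialHom_unitary μ σ hμ x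
    have h1 : (P : Matrix (Fin n) (Fin n) K) * (f x).1 = monomialHom μ x * P := by
      rw [hf, ← Units.val_mul, mul_assoc, mul_inv_cancel_left]
      rfl
    change (f x).1ᵀ * _ * (f x).1.map σ = _
    calc _ = ((P : Matrix (Fin n) (Fin n) K) * (f x).1)ᵀ *
          ((P : Matrix (Fin n) (Fin n) K) * (f x).1).map σ := by
          simp only [Matrix.transpose_mul, Matrix.map_mul, Matrix.mul_assoc]
      _ = (P : Matrix (Fin n) (Fin n) K)ᵀ * ((monomialHom μ x)ᵀ * (monomialHom μ x).map σ) *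
          (P : Matrix (Fin n) (Fin n) K).map σ := by
          rw [h1]
          simp only [Matrix.transpose_mul, Matrix.map_mul, Matrix.mul_assoc]
      _ = _ := by rw [hx, Matrix.mul_one]
  refine Subgroup.card_dvd_of_injective (f.codRestrict _ hmem) fun x y hxy => ?_
  have hxy' : f x = f y := congrArg Subtype.val hxy
  have h2 := (MulAut.conj P⁻¹).injective hxy'
  exact monomialHom_injective μ (congrArg Units.val h2)

/-- Lifting the exponent gives v(q ^ (2m) - 1) = v(q² - 1) + v(m), and `l` odd dividing q + 1 cannot
divide q - 1. -/
theorem padicValNat_prod_pow_sub_one {l q : ℕ} (hl : l.Prime) (hl2 : l ≠ 2) (hq : 1 < q)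
    (hlq : l ∣ q + 1) (n : ℕ) :
    padicValNat l (∏ j ∈ Finset.range n, ((q ^ 2) ^ (j + 1) - 1)) =
      padicValNat l ((q + 1) ^ n * n.factorial) := by
  have := Fact.mk hl
  have hfac : q ^ 2 - 1 = (q + 1) * (q - 1) := by simpa using Nat.sq_sub_sq q 1
  have hq1 : ¬ l ∣ q - 1 := fun h => by
    have h2 : l ∣ 2 := by
      have := (Nat.dvd_sub hlq h)
      rwa [show q + 1 - (q - 1) = 2 by omega] at this
    exact hl2 ((Nat.prime_dvd_prime_iff_eq hl Nat.prime_two).1 h2)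
  have hlq2 : ¬ l ∣ q ^ 2 := fun h => by
    have h1 := hl.dvd_of_dvd_pow h
    have := (Nat.dvd_add_right h1).1 hlq
    exact hl.one_lt.ne' (Nat.dvd_one.1 this)
  have hpos : ∀ j, (q ^ 2) ^ (j + 1) - 1 ≠ 0 := fun j => by
    have : 1 < (q ^ 2) ^ (j + 1) := Nat.one_lt_pow (by omega) (Nat.one_lt_pow two_ne_zero hq)
    omega
  induction n with
  | zero => simp
  | succ n ih =>
    have hterm : padicValNat l ((q ^ 2) ^ (n + 1) - 1) =
        padicValNat l (q + 1) + padicValNat l (n + 1) := by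
      have h1 := padicValNat.pow_sub_pow (p := l) (hl.odd_of_ne_two hl2) (x := q ^ 2) (y := 1)
        (Nat.one_lt_pow two_ne_zero hq) (hfac ▸ hlq.mul_right _) hlq2 (n := n + 1) (by omega)
      rw [one_pow] at h1
      rw [h1, hfac, padicValNat.mul (by omega) (by omega), padicValNat.eq_zero_of_not_dvd hq1,
        add_zero]
    rw [Finset.prod_range_succ, padicValNat.mul (Finset.prod_ne_zero_iff.2 fun j _ => hpos j)
      (hpos n), ih, hterm, Nat.factorial_succ, pow_succ,
      show (q + 1) ^ n * (q + 1) * ((n + 1) * n.factorial) =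
        (q + 1) ^ n * n.factorial * ((q + 1) * (n + 1)) by ring,
      padicValNat.mul (mul_ne_zero (by positivity) n.factorial_ne_zero) (by positivity),
      padicValNat.mul (a := q + 1) (by omega) (by omega)]

/-- Here `c` stands for [GL : U], `d` for the cofactor of the monomial group in |U|, and the product
is |GL|. Comparing valuations leaves nothing for `c`. -/
theorem not_dvd_of_mul_pow_factorial_mul_eq {l q c d : ℕ} (hl : l.Prime) (hl2 : l ≠ 2) (hq : 1 < q)
    (hlq : l ∣ q + 1) (n : ℕ)
    (h : c * ((q + 1) ^ n * n.factorial * d) = ∏ i : Fin n, ((q ^ 2) ^ n - (q ^ 2) ^ i.1)) :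
    ¬ l ∣ c := by
  have := Fact.mk hl
  have hlq2 : ¬ l ∣ q ^ 2 := fun h => by
    have h1 := hl.dvd_of_dvd_pow h
    have := (Nat.dvd_add_right h1).1 hlq
    exact hl.one_lt.ne' (Nat.dvd_one.1 this)
  have hprod : ∏ i : Fin n, ((q ^ 2) ^ n - (q ^ 2) ^ i.1) =
      (∏ i ∈ Finset.range n, (q ^ 2) ^ i) * ∏ j ∈ Finset.range n, ((q ^ 2) ^ (j + 1) - 1) := by
    rw [Fin.prod_univ_eq_prod_range (fun i => (q ^ 2) ^ n - (q ^ 2) ^ i) n,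
      ← Finset.prod_range_reflect (fun j => (q ^ 2) ^ (j + 1) - 1), ← Finset.prod_mul_distrib]
    refine Finset.prod_congr rfl fun i hi => ?_
    have hi' := Finset.mem_range.1 hi
    rw [Nat.mul_sub, mul_one, ← pow_add]
    congr 2
    omega
  have hpos : ∏ j ∈ Finset.range n, ((q ^ 2) ^ (j + 1) - 1) ≠ 0 := by
    refine Finset.prod_ne_zero_iff.2 fun j _ => ?_
    have : 1 < (q ^ 2) ^ (j + 1) := Nat.one_lt_pow (by omega) (Nat.one_lt_pow two_ne_zero hq)
    omega
  have hpos' : ∏ i ∈ Finset.range n, (q ^ 2) ^ i ≠ 0 :=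
    Finset.prod_ne_zero_iff.2 fun i _ => by positivity
  have hndvd : ¬ l ∣ ∏ i ∈ Finset.range n, (q ^ 2) ^ i := by
    rw [hl.prime.dvd_finsetProd_iff]
    rintro ⟨i, -, hi⟩
    exact hlq2 (hl.dvd_of_dvd_pow hi)
  have hne := mul_ne_zero hpos' hpos
  rw [hprod] at h
  rw [← h] at hne
  have hc : c ≠ 0 := left_ne_zero_of_mul hne
  have hd : d ≠ 0 := right_ne_zero_of_mul (right_ne_zero_of_mul hne)
  have hm : (q + 1) ^ n * n.factorial ≠ 0 := left_ne_zero_of_mul (right_ne_zero_of_mul hne)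
  have hval := congrArg (padicValNat l) h
  rw [padicValNat.mul hc (mul_ne_zero hm hd), padicValNat.mul hm hd, padicValNat.mul hpos' hpos,
    padicValNat.eq_zero_of_not_dvd hndvd, padicValNat_prod_pow_sub_one hl hl2 hq hlq] at hval
  intro hlc
  have := one_le_padicValNat_of_dvd hc hlc
  omega

variable {K : Type*} [Field K] [Finite K] {p r l : ℕ} [Fact p.Prime] [CharP K p]
  {β : Matrix (Fin n) (Fin n) K}

theorem not_dvd_index_matUnitary (hK : Nat.card K = (p ^ r) ^ 2) (hl : l.Prime) (hl2 : l ≠ 2)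
    (hlq : l ∣ p ^ r + 1) (hβ : IsUnit β.det) (hherm : βᵀ = β.map (iterateFrobenius K p r)) :
    ¬ l ∣ (matUnitary (iterateFrobenius K p r) β).index := by
  have := Fintype.ofFinite K
  have hq := one_lt_of_card_eq hK
  obtain ⟨P, rfl⟩ := exists_transpose_mul_map_eq (iterateFrobenius_involutive hK)
    (exists_add_iterateFrobenius_ne_zero hK) (exists_mul_iterateFrobenius_eq hK) hβ hherm
  -- The power `g ^ (q - 1)` of a generator has order q + 1, so its powers have norm 1.
  obtain ⟨g, hg⟩ := IsCyclic.exists_ofOrder_eq_natCard (α := Kˣ)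
  rw [card_units_eq hK] at hg
  have hord : orderOf (g ^ (p ^ r - 1)) = p ^ r + 1 := by
    rw [orderOf_pow_of_dvd (by omega) (hg ▸ dvd_mul_right _ _), hg,
      Nat.mul_div_cancel_left _ (by omega)]
  obtain ⟨d, hd⟩ := pow_mul_factorial_dvd_card_matUnitary (Subgroup.zpowers (g ^ (p ^ r - 1)))
    (iterateFrobenius K p r) (by
      intro x hx
      have h1 : x ^ (p ^ r + 1) = 1 :=
        orderOf_dvd_iff_pow_eq_one.1 (hord ▸ orderOf_dvd_of_mem_zpowers hx)
      rw [iterateFrobenius_def, ← pow_succ', ← Units.val_pow_eq_pow_val, h1, Units.val_one]) P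
  rw [Nat.card_zpowers, hord] at hd
  refine not_dvd_of_mul_pow_factorial_mul_eq hl hl2 hq hlq n (d := d) ?_
  rw [← hd, Subgroup.index_mul_card, Matrix.card_GL_field, ← Nat.card_eq_fintype_card, hK]

end Index

/-! ### Determinants and the index of SU -/

section Main

variable {n : ℕ} {K : Type*} [Field K] {p r l : ℕ} [Fact p.Prime] [CharP K p]
  {β : Matrix (Fin n) (Fin n) K}

theorem det_pow_of_mem_matUnitary (hβ : IsUnit β.det) {M : GL (Fin n) K}
    (hM : M ∈ matUnitary (iterateFrobenius K p r) β) :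
    Matrix.GeneralLinearGroup.det M ^ (p ^ r + 1) = 1 := by
  have h : M.1ᵀ * β * M.1.map (iterateFrobenius K p r) = β := hM
  have h1 := congrArg Matrix.det h
  rw [Matrix.det_mul, Matrix.det_mul, Matrix.det_transpose, ← RingHom.mapMatrix_apply,
    ← RingHom.map_det, iterateFrobenius_def] at h1
  apply Units.ext
  have h2 : β.det * M.1.det ^ (p ^ r + 1) = β.det * 1 := by
    rw [mul_one]
    conv_rhs => rw [← h1]
    ring
  simpa using mul_left_cancel₀ hβ.ne_zero h2

/-- The index is the order of the determinant image. By Cauchy, `l` dividing it gives an element of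
order `l`, whose order divides q + 1. -/
theorem not_dvd_relIndex_matSpecialUnitary [Finite K] (hl : l.Prime) (hlq : ¬ l ∣ p ^ r + 1)
    (hβ : IsUnit β.det) :
    ¬ l ∣ (matSpecialUnitary (iterateFrobenius K p r) β).relIndex
      (matUnitary (iterateFrobenius K p r) β) := by
  intro h
  apply hlq
  rw [matSpecialUnitary, Subgroup.inf_relIndex_left, Subgroup.relIndex_ker] at h
  have := Fact.mk hl
  obtain ⟨x, hx⟩ := exists_prime_orderOf_dvd_card' l h
  obtain ⟨_, M, hM, rfl⟩ := x
  rw [← hx]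
  exact orderOf_dvd_of_pow_eq_one (Subtype.ext (det_pow_of_mem_matUnitary hβ hM))

/-- Computing the index of U ∩ N through U and through N gives [N : U ∩ N][G : N] = [U : U ∩ N][G :
U]. Normality makes [U : U ∩ N] divide [G : N], and it cancels. -/
theorem relIndex_dvd_index_of_normal_right {G : Type*} [Group G] [Finite G] (U N : Subgroup G)
    [N.Normal] : U.relIndex N ∣ U.index := by
  have h1 : U.relIndex N * N.index = N.relIndex U * U.index := by
    rw [← Subgroup.inf_relIndex_right, ← Subgroup.inf_relIndex_right N U,
      Subgroup.relIndex_mul_index inf_le_right, Subgroup.relIndex_mul_index inf_le_right, inf_comm]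
  obtain ⟨c, hc⟩ := Subgroup.relIndex_dvd_index_of_normal N U
  have hpos : N.relIndex U ≠ 0 := Subgroup.index_ne_zero_of_finite
  refine ⟨c, (Nat.eq_of_mul_eq_mul_left (Nat.pos_of_ne_zero hpos) ?_).symm⟩
  rw [← h1, hc]
  ring

/-- The inclusion of the special unitary group in the special linear group. -/
def matSpecialUnitaryToSL (σ : K →+* K) (β : Matrix (Fin n) (Fin n) K) :
    matSpecialUnitary σ β →* Matrix.SpecialLinearGroup (Fin n) K where
  toFun M := ⟨M.1.1, congrArg Units.val M.2.2⟩
  map_one' := rfl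
  map_mul' _ _ := rfl

theorem matSpecialUnitaryToSL_injective (σ : K →+* K) (β : Matrix (Fin n) (Fin n) K) :
    Function.Injective (matSpecialUnitaryToSL σ β) := fun _ _ h =>
  Subtype.ext (Units.ext (congrArg Subtype.val h))

theorem range_matSpecialUnitaryToSL (σ : K →+* K) (β : Matrix (Fin n) (Fin n) K) :
    (matSpecialUnitaryToSL σ β).range =
      (matUnitary σ β).comap Matrix.SpecialLinearGroup.toGL := by
  ext M
  constructor
  · rintro ⟨M, rfl⟩
    exact M.2.1
  · intro hM
    exact ⟨⟨Matrix.SpecialLinearGroup.toGL M, hM, Units.ext M.2⟩, rfl⟩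

theorem range_toGL : (Matrix.SpecialLinearGroup.toGL (n := Fin n) (R := K)).range =
    (Matrix.GeneralLinearGroup.det (n := Fin n) (R := K)).ker := by
  ext M
  constructor
  · rintro ⟨M, rfl⟩
    exact Units.ext M.2
  · intro hM
    exact ⟨⟨M.1, congrArg Units.val hM⟩, Units.ext rfl⟩

end Main

end

/-- Here `K` is the field with `q ^ 2` elements, `q = p ^ r`; its conjugation over the subfield
with `q` elements is `iterateFrobenius K p r : x ↦ x ^ (p ^ r)`; and `β` is any nondegenerate
Hermitian matrix. -/
theorem theorem10p1 (p r l n : ℕ) [Fact p.Prime] (hl : l.Prime) (hl2 : l ≠ 2) (hlp : l ≠ p)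
    (k : Type u) [Field k] (hk : ringChar k ≠ l)
    (K : Type v) [Field K] [Finite K] [CharP K p] (hK : Nat.card K = (p ^ r) ^ 2)
    (β : Matrix (Fin n) (Fin n) K) (hβ : IsUnit β.det)
    (hβherm : βᵀ = β.map (iterateFrobenius K p r)) :
    (¬ l ∣ p ^ r + 1 →
      essentialDim k (matSpecialUnitary (iterateFrobenius K p r) β) l =
        essentialDim k (matUnitary (iterateFrobenius K p r) β) l) ∧
    (l ∣ p ^ r + 1 →
      essentialDim k (matSpecialUnitary (iterateFrobenius K p r) β) l =
        essentialDim k (Matrix.SpecialLinearGroup (Fin n) K) l) := by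
  constructor
  · intro hlq
    have hle : matSpecialUnitary (iterateFrobenius K p r) β ≤
      matUnitary (iterateFrobenius K p r) β := inf_le_left
    refine essentialDim_eq_of_injective (Subgroup.inclusion hle)
      (Subgroup.inclusion_injective _) hl ?_
    rw [Subgroup.inclusion_range]
    exact not_dvd_relIndex_matSpecialUnitary hl hlq hβ
  · intro hlq
    refine essentialDim_eq_of_injective _ (matSpecialUnitaryToSL_injective _ β) hl fun h => ?_
    rw [range_matSpecialUnitaryToSL, Subgroup.index_comap, range_toGL] at h
    exact not_dvd_index_matUnitary hK hl hl2 hlq hβ hβherm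
      (h.trans (relIndex_dvd_index_of_normal_right _ _))
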